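/- Let $d \ge 2$ be an integer and let $0 < \alpha < 1$. Given a finite set $S \subset \mathbb{R}^d$, a \emph{quasi-Rips complex with parameter $\alpha$ on $S$} is an abstract simplicial complex $\Gamma$ with vertex set $S$ that is a flag complex (a nonempty subset of $S$ is a face whenever all of its $2$-element subsets are faces) and such that, for distinct $u,v \in S$, $\{u,v\}$ is a face if $\mathrm{dist}(u,v) \le \alpha$ and is not a face if $\mathrm{dist}(u,v) > 1$ (Euclidean distance); if $\alpha < \mathrm{dist}(u,v) \le 1$, the edge may be present or absent. For a field $\mathbf{k}$, let $\tilde\beta_2(\Gamma;\mathbf{k}) = \dim_{\mathbf{k}} \tilde H_2(\Gamma;\mathbf{k})$, and let $M^{\alpha}_{2,d}(n)$ be the maximum of $\tilde\beta_2(\Gamma;\mathbf{k})$ over all quasi-Rips complexes $\Gamma$ with parameter $\alpha$ on sets $S \subset \mathbb{R}^d$ with $|S| \le n$. A \emph{matching} in a graph is a set of edges no two of which have a common endpoint. A matching $M$ in a bipartite graph $G$ with vertex set $U \sqcup V$ is \emph{induced} if, whenever $uv$ and $u'v'$ are two different edges in $M$ with $u,u' \in U$ and $v,v' \in V$, neither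 $uv'$ nor $u'v$ is an edge of $G$. Let $I(n)$ be the maximum of $\sum_{i=1}^t |M_i|$ over all bipartite graphs $G$ with vertex set $U \sqcup V$, $|U|, |V| \le n$, and all families of $t \le n$ pairwise disjoint (as sets of edges) induced matchings $M_1,\dots,M_t$ in $G$. Then there exist constants $C_{d,\alpha} > 0$ and $D_{d,\alpha} > 0$ and an integer $N$, all depending only on $d$ and $\alpha$, such that for every field $\mathbf{k}$ and all $n \ge N$, $$C_{d,\alpha}\, I(n) < M^{\alpha}_{2,d}(n) < D_{d,\alpha}\, I(n).$$ -/

import Mathlib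

noncomputable section

namespace QuasiRips

section Homology

variable (k : Type*) [Field k] {V : Type*}

/-- The boundary operator on simplicial chains, for a linearly ordered set of vertices: the
simplex with vertices `v₀ < v₁ < ⋯ < vₘ` is sent to `∑ i, (-1) ^ i • (v₀ … v̂ᵢ … vₘ)`. All chain
groups live in the single space `Finset V →₀ k`. The empty simplex is present, in degree `-1`, so
that on vertices the operator is the augmentation. -/
def boundary [LinearOrder V] : (Finset V →₀ k) →ₗ[k] (Finset V →₀ k) :=
  Finsupp.lsum k fun s : Finset V =>
    ∑ v ∈ s, (-1 : k) ^ (s.filter (· < v)).card • Finsupp.lsingle (s.erase v)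

/-- The simplicial chains of `K` that are combinations of faces with exactly `m` vertices. The
empty set counts as a face. -/
def chains (K : AbstractSimplicialComplex V) (m : ℕ) : Submodule k (Finset V →₀ k) :=
  Finsupp.supported k k {s : Finset V | (s = ∅ ∨ s ∈ K) ∧ s.card = m}

/-- The reduced simplicial `p`-cycles of `K`. -/
def cycles [LinearOrder V] (K : AbstractSimplicialComplex V) (p : ℕ) :
    Submodule k (Finset V →₀ k) :=
  chains k K (p + 1) ⊓ LinearMap.ker (boundary k)

/-- The simplicial `p`-boundaries of `K`. -/
def boundaries [LinearOrder V] (K : AbstractSimplicialComplex V) (p : ℕ) :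
    Submodule k (Finset V →₀ k) :=
  (chains k K (p + 2)).map (boundary k)

set_option maxSynthPendingDepth 4 in
/-- The reduced simplicial homology of `K` in degree `p` with coefficients in `k`. -/
abbrev ReducedHomology [LinearOrder V] (K : AbstractSimplicialComplex V) (p : ℕ) : Type _ :=
  cycles k K p ⧸ (boundaries k K p).submoduleOf (cycles k K p)

/-- The reduced topological Betti number `β̃_p(K; k)`. The orientation of the simplices comes from
some linear order on the vertices; the Betti number does not depend on that order. -/
def reducedBetti (K : AbstractSimplicialComplex V) (p : ℕ) : ℕ :=
  letI : LinearOrder V := open Classical in linearOrderOfSTO WellOrderingRel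
  Module.finrank k (ReducedHomology k K p)

theorem boundary_single [LinearOrder V] (s : Finset V) (c : k) :
    boundary k (Finsupp.single s c) =
      ∑ v ∈ s, Finsupp.single (s.erase v) ((-1 : k) ^ (s.filter (· < v)).card * c) := by
  simp [boundary]

/-- The square of the boundary operator vanishes. -/
theorem boundary_boundary [LinearOrder V] (x : Finset V →₀ k) :
    boundary k (boundary k x) = 0 := by
  induction x using Finsupp.induction_linear with
  | zero => simp
  | add f g hf hg => simp [hf, hg]
  | single s c =>
    rw [boundary_single, map_sum]
    simp only [boundary_single]
    rw [Finset.sum_sigma']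
    have key : ∀ v w : V, v ∈ s → w < v →
        (-1 : k) ^ ((s.erase v).filter (· < w)).card * ((-1 : k) ^ (s.filter (· < v)).card * c) +
        (-1 : k) ^ ((s.erase w).filter (· < v)).card * ((-1 : k) ^ (s.filter (· < w)).card * c)
          = 0 ∨ w ∉ s := by
      intro v w hv hwv
      by_cases hw : w ∈ s
      · left
        have h1 : (s.erase v).filter (· < w) = s.filter (· < w) := by
          ext x; simp only [Finset.mem_filter, Finset.mem_erase]
          constructor
          · rintro ⟨⟨_, h⟩, h'⟩; exact ⟨h, h'⟩
          · rintro ⟨h, h'⟩; exact ⟨⟨(h'.trans hwv).ne, h⟩, h'⟩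
        have h2 : (s.erase w).filter (· < v) = (s.filter (· < v)).erase w := by
          ext x; simp only [Finset.mem_filter, Finset.mem_erase]; tauto
        have hmem : w ∈ s.filter (· < v) := by simp [hw, hwv]
        have h3 := Finset.card_erase_add_one hmem
        rw [h1, h2, ← h3, pow_succ]
        ring
      · right; exact hw
    refine Finset.sum_involution (fun p _ => ⟨p.2, p.1⟩) ?_ ?_ ?_ ?_
    · rintro ⟨v, w⟩ h
      simp only [Finset.mem_sigma, Finset.mem_erase] at h
      obtain ⟨hv, hwv, hw⟩ := h
      dsimp only
      rw [Finset.erase_right_comm, ← Finsupp.single_add, Finsupp.single_eq_zero]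
      rcases lt_or_gt_of_ne hwv with hlt | hlt
      · exact (key v w hv hlt).resolve_right (by simpa using hw)
      · rw [add_comm]
        exact (key w v hw hlt).resolve_right (by simpa using hv)
    · rintro ⟨v, w⟩ h _ heq
      simp only [Finset.mem_sigma, Finset.mem_erase] at h
      simp only [Sigma.mk.injEq] at heq
      exact h.2.1 heq.1
    · rintro ⟨v, w⟩ h
      simp only [Finset.mem_sigma, Finset.mem_erase] at h ⊢
      exact ⟨h.2.2, h.2.1.symm, h.1⟩
    · rintro ⟨v, w⟩ _
      rfl

/-- Boundaries are cycles. -/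
theorem boundaries_le_cycles [LinearOrder V] (K : AbstractSimplicialComplex V) (p : ℕ) :
    boundaries k K p ≤ cycles k K p := by
  rw [boundaries, Submodule.map_le_iff_le_comap, chains, Finsupp.supported_eq_span_single,
    Submodule.span_le]
  rintro _ ⟨s, ⟨hs, hc⟩, rfl⟩
  refine Submodule.mem_inf.2 ⟨?_, boundary_boundary k _⟩
  rw [boundary_single]
  refine Submodule.sum_mem _ fun v hv => Finsupp.single_mem_supported k _ ⟨?_, ?_⟩
  · rcases Finset.eq_empty_or_nonempty (s.erase v) with h | h
    · exact Or.inl h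
    · right
      have hsK : s ∈ K := hs.resolve_left (by rintro rfl; simp at hv)
      exact (K.isRelLowerSet_faces hsK).2 (Finset.erase_subset v s) h
  · rw [Finset.card_erase_of_mem hv, hc]; rfl

theorem reducedBetti_le [Fintype V] (K : AbstractSimplicialComplex V) (p : ℕ) :
    reducedBetti k K p ≤ 2 ^ Fintype.card V := by
  unfold reducedBetti
  letI : LinearOrder V := open Classical in linearOrderOfSTO WellOrderingRel
  calc Module.finrank k (ReducedHomology k K p)
      ≤ Module.finrank k (cycles k K p) := Submodule.finrank_quotient_le _
    _ ≤ Module.finrank k (Finset V →₀ k) := Submodule.finrank_le _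
    _ = 2 ^ Fintype.card V := by rw [Module.finrank_finsupp_self, Fintype.card_finset]

end Homology

section Complexes

open Classical in
/-- A flag complex: every (nonempty, finite) set of vertices, all of whose `2`-subsets are edges,
is a face. -/
def IsFlag {V : Type*} (K : AbstractSimplicialComplex V) : Prop :=
  ∀ s : Finset V, s.Nonempty → (∀ u ∈ s, ∀ v ∈ s, u ≠ v → {u, v} ∈ K) → s ∈ K

open Classical in
/-- `K` is a quasi-Rips complex with parameter `α` on the finite point set `S ⊆ ℝ ^ d`. -/
structure IsQuasiRips {d : ℕ} (α : ℝ) (S : Finset (EuclideanSpace ℝ (Fin d)))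
    (K : AbstractSimplicialComplex S) : Prop where
  isFlag : IsFlag K
  edge_of_dist_le : ∀ u v : S, u ≠ v →
    dist (u : EuclideanSpace ℝ (Fin d)) v ≤ α → {u, v} ∈ K
  not_edge_of_lt_dist : ∀ u v : S, u ≠ v →
    1 < dist (u : EuclideanSpace ℝ (Fin d)) v → {u, v} ∉ K

/-- The `p`-th reduced Betti numbers over `k` of the quasi-Rips complexes with parameter `α` on
at most `n` points of `ℝ ^ d`. -/
def quasiRipsBettiSet (k : Type*) [Field k] (α : ℝ) (p d n : ℕ) : Set ℕ :=
  {b | ∃ (S : Finset (EuclideanSpace ℝ (Fin d))) (K : AbstractSimplicialComplex S),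
    S.card ≤ n ∧ IsQuasiRips α S K ∧ reducedBetti k K p = b}

/-- `M^α_{p,d}(n)`, over the field `k`: the maximum of the `p`-th reduced Betti numbers of the
quasi-Rips complexes with parameter `α` on at most `n` points of `ℝ ^ d`. -/
def maxQuasiRipsBetti (k : Type*) [Field k] (α : ℝ) (p d n : ℕ) : ℕ :=
  sSup (quasiRipsBettiSet k α p d n)

/-- The supremum in the definition of `maxQuasiRipsBetti` is a maximum. -/
theorem isGreatest_maxQuasiRipsBetti (k : Type*) [Field k] (α : ℝ) (p d n : ℕ) :
    IsGreatest (quasiRipsBettiSet k α p d n) (maxQuasiRipsBetti k α p d n) := by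
  have hb : BddAbove (quasiRipsBettiSet k α p d n) := by
    refine ⟨2 ^ n, ?_⟩
    rintro _ ⟨S, K, hS, -, rfl⟩
    refine (reducedBetti_le k K p).trans (Nat.pow_le_pow_right (by norm_num) ?_)
    simpa using hS
  have hne : (quasiRipsBettiSet k α p d n).Nonempty := by
    refine ⟨_, ∅, ⊥, by simp, ⟨?_, ?_, ?_⟩, rfl⟩
    · rintro s ⟨x, -⟩ -
      exact absurd x.2 (Finset.notMem_empty _)
    · intro u; exact absurd u.2 (Finset.notMem_empty _)
    · intro u; exact absurd u.2 (Finset.notMem_empty _)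
  exact ⟨Nat.sSup_mem hne hb, fun b hbm => le_csSup hb hbm⟩

end Complexes

section Matchings

/-- `M` is an induced matching in the graph `G` with vertex parts `U` and `V`: a set of edges of
`G`, no two of which have a common endpoint, such that for any two different edges `uv`, `u'v'` of
`M` with `u, u' ∈ U` and `v, v' ∈ V`, neither `uv'` nor `u'v` is an edge of `G`. -/
structure IsInducedMatching {W : Type*} (G : SimpleGraph W) (U V : Finset W)
    (M : Finset (Sym2 W)) : Prop where
  subset_edgeSet : ∀ e ∈ M, e ∈ G.edgeSet
  matching : ∀ e ∈ M, ∀ f ∈ M, e ≠ f → ∀ w, w ∈ e → w ∉ f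
  induced : ∀ u ∈ U, ∀ u' ∈ U, ∀ v ∈ V, ∀ v' ∈ V, s(u, v) ∈ M → s(u', v') ∈ M →
    s(u, v) ≠ s(u', v') → ¬ G.Adj u v' ∧ ¬ G.Adj u' v

/-- The total sizes `∑ |M_i|` of families of `t ≤ n` disjoint induced matchings in a bipartite
graph with vertex set `U ⊔ V`, where `|U|, |V| ≤ n`. -/
def inducedMatchingSizes (n : ℕ) : Set ℕ :=
  {m | ∃ (W : Type) (G : SimpleGraph W) (U V : Finset W) (t : ℕ)
      (M : Fin t → Finset (Sym2 W)),
    G.IsBipartiteWith (U : Set W) (V : Set W) ∧ (U : Set W) ∪ (V : Set W) = Set.univ ∧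
    U.card ≤ n ∧ V.card ≤ n ∧ t ≤ n ∧
    (∀ i, IsInducedMatching G U V (M i)) ∧ (∀ i j, i ≠ j → Disjoint (M i) (M j)) ∧
    ∑ i, (M i).card = m}

/-- `I(n)`: the maximum total size of at most `n` disjoint induced matchings in a bipartite graph
with at most `n` vertices on each side. -/
def maxInducedMatchings (n : ℕ) : ℕ :=
  sSup (inducedMatchingSizes n)

/-- The supremum in the definition of `maxInducedMatchings` is a maximum. -/
theorem isGreatest_maxInducedMatchings (n : ℕ) :
    IsGreatest (inducedMatchingSizes n) (maxInducedMatchings n) := by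
  classical
  have hb : BddAbove (inducedMatchingSizes n) := by
    refine ⟨n * n, ?_⟩
    rintro _ ⟨W, G, U, V, t, M, hG, -, hU, hV, -, hM, hd, rfl⟩
    rw [← Finset.card_biUnion (fun i _ j _ hij => hd i j hij)]
    have hsub : Finset.univ.biUnion M ⊆ (U ×ˢ V).image (fun q => s(q.1, q.2)) := by
      intro e he
      obtain ⟨i, -, hi⟩ := Finset.mem_biUnion.1 he
      have hadj := (hM i).subset_edgeSet e hi
      induction e using Sym2.ind with
      | _ a b =>
        rw [SimpleGraph.mem_edgeSet] at hadj
        rw [Finset.mem_image]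
        rcases hG.mem_of_adj hadj with ⟨ha, hb⟩ | ⟨ha, hb⟩
        · exact ⟨(a, b), by simpa using ⟨ha, hb⟩, rfl⟩
        · exact ⟨(b, a), by simpa using ⟨hb, ha⟩, Sym2.eq_swap⟩
    calc (Finset.univ.biUnion M).card
        ≤ ((U ×ˢ V).image (fun q => s(q.1, q.2))).card := Finset.card_le_card hsub
      _ ≤ (U ×ˢ V).card := Finset.card_image_le
      _ = U.card * V.card := Finset.card_product U V
      _ ≤ n * n := Nat.mul_le_mul hU hV
  have hne : (inducedMatchingSizes n).Nonempty := by
    refine ⟨_, Empty, ⊥, ∅, ∅, 0, fun _ => ∅, ⟨by simp, by simp⟩, ?_, by simp, by simp, by simp,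
      fun i => i.elim0, fun i => i.elim0, rfl⟩
    ext x; exact x.elim
  exact ⟨Nat.sSup_mem hne hb, fun b hbm => le_csSup hb hbm⟩

end Matchings

end QuasiRips

end

/-! Upper bound. A periodic grid colours `ℝ ^ d` with `m` colours, `m` depending only on `d` and
`α`, so that two vertices of one colour with a common neighbour are adjacent. Add the vertices in
increasing order. By a Mayer–Vietoris argument (`finrank_cliqueCycles_Iic_le`), a new vertex `w`
raises the second Betti number by at most the first Betti number of the complex on its earlier
neighbours. There every colour class is a clique, so modulo triangles and edges inside colours, `uv`
is a multiple of `u'v'` as soon as `u, u'` share a colour, `v, v'` share a colour and `uv'` is an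
edge. Hence edges that are independent modulo these relations form, for each pair of colours, an
induced matching (`exists_independent_edges`). An edge already seen by an earlier vertex `w'` of the
colour of `w` is redundant, because `w'` is itself an earlier neighbour of `w`; so vertices of one
colour get disjoint matchings. Summing over two edge colours and the colour of `w` gives the bound
`m ^ 3 * I(n)`.

Lower bound. Place clusters near the vertices of a 60 degree rhombus of side slightly below `1`.
Five of the six pairs of clusters are at distance between `α` and `1`, so edges between them are
free; only the pair on the long diagonal is too far apart. Two adjacent clusters carry the sides of
the bipartite graph, with one extra vertex each. The two far ones carry an apex for each matching,
joined to the vertices that it covers, and a single pole. Each edge of a matching yields an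
octahedron with a distinguished triangle: the edge together with its apex. Inducedness and
disjointness of the matchings make this triangle a facet, so boundaries vanish on it and the
octahedra are independent in homology (`card_le_finrank_reducedHomology`). This complex has about
three times as many vertices as one side, so both sides and the set of matchings are first cut into
four blocks, at the cost of a factor `64`. -/

noncomputable section

namespace QuasiRips

/-! ### Cone and link operators on simplicial chains. -/

section Cone

/-- Linear maps on chains are determined by their values on simplices. -/
theorem chain_hom_ext (k : Type*) [Field k] {V M : Type*} [AddCommGroup M] [Module k M]
    {f g : (Finset V →₀ k) →ₗ[k] M}
    (h : ∀ s, f (Finsupp.single s 1) = g (Finsupp.single s 1)) : f = g :=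
  Finsupp.lhom_ext' fun s => LinearMap.ext_ring (h s)

variable (k : Type*) [Field k] {V : Type*} [LinearOrder V]

/-- The sign with which `v` sits in the simplex `s`. -/
def orientationSign (v : V) (s : Finset V) : k := (-1) ^ (s.filter (· < v)).card

theorem orientationSign_mul_self (v : V) (s : Finset V) :
    orientationSign k v s * orientationSign k v s = 1 := by
  rw [orientationSign, ← pow_add, ← two_mul, pow_mul]; simp

theorem orientationSign_ne_zero (v : V) (s : Finset V) : orientationSign k v s ≠ 0 :=
  pow_ne_zero _ (by simp)

theorem orientationSign_insert_self (v : V) (s : Finset V) :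
    orientationSign k v (insert v s) = orientationSign k v s := by
  simp [orientationSign, Finset.filter_insert]

theorem orientationSign_erase_self (v : V) (s : Finset V) :
    orientationSign k v (s.erase v) = orientationSign k v s := by
  simp [orientationSign, Finset.filter_erase]

/-- Exactly one of the two signs flips, depending on which of `v` and `w` comes first. This is the
anticommutation of two vertices. -/
theorem orientationSign_insert_mul {v w : V} {s : Finset V} (hv : v ∈ s) (hw : w ∉ s) :
    orientationSign k v (insert w s) * orientationSign k w s =
      - (orientationSign k w (s.erase v) * orientationSign k v s) := by
  have hvw : v ≠ w := by rintro rfl; exact hw hv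
  unfold orientationSign
  rcases lt_or_gt_of_ne hvw with h | h
  · have h1 : (insert w s).filter (· < v) = s.filter (· < v) := by
      rw [Finset.filter_insert, if_neg h.not_gt]
    have h2 : (s.erase v).filter (· < w) = (s.filter (· < w)).erase v := Finset.filter_erase ..
    have h3 := Finset.card_erase_add_one (s := s.filter (· < w)) (a := v) (by simp [hv, h])
    rw [h1, h2, ← h3, pow_succ]; ring
  · have h1 : (insert w s).filter (· < v) = insert w (s.filter (· < v)) := by
      rw [Finset.filter_insert, if_pos h]
    have h2 : (s.erase v).filter (· < w) = s.filter (· < w) := by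
      rw [Finset.filter_erase, Finset.erase_eq_of_notMem]; simp [h.le]
    rw [h1, h2, Finset.card_insert_of_notMem (by simp [hw]), pow_succ]; ring

theorem boundary_single_one (s : Finset V) :
    boundary k (Finsupp.single s 1) =
      ∑ v ∈ s, orientationSign k v s • Finsupp.single (s.erase v) (1 : k) := by
  simp [boundary_single, orientationSign]

/-- The cone operator with apex `w`: exterior multiplication by `w` on the left. -/
def cone (w : V) : (Finset V →₀ k) →ₗ[k] (Finset V →₀ k) :=
  Finsupp.lsum k fun s : Finset V =>
    if w ∈ s then 0 else orientationSign k w s • Finsupp.lsingle (insert w s)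

theorem cone_single (w : V) (s : Finset V) :
    cone k w (Finsupp.single s 1) =
      if w ∈ s then 0 else orientationSign k w s • Finsupp.single (insert w s) (1 : k) := by
  unfold cone
  rw [Finsupp.lsum_single]
  split_ifs <;> simp

/-- Coning is a contracting homotopy of the full simplex. If `w ∈ s`, only the face opposite `w`
survives coning; if `w ∉ s`, the faces through `w` cancel in pairs and `s` remains. -/
theorem boundary_cone_add_cone_boundary (w : V) (x : Finset V →₀ k) :
    boundary k (cone k w x) + cone k w (boundary k x) = x := by
  suffices h : boundary k ∘ₗ cone k w + cone k w ∘ₗ boundary k = LinearMap.id from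
    LinearMap.congr_fun h x
  refine chain_hom_ext k fun s => ?_
  simp only [LinearMap.add_apply, LinearMap.comp_apply, LinearMap.id_apply, cone_single]
  by_cases hw : w ∈ s
  · rw [if_pos hw, map_zero, zero_add, boundary_single_one, map_sum,
      Finset.sum_eq_single_of_mem w hw]
    · rw [map_smul, cone_single, if_neg (Finset.notMem_erase w s), orientationSign_erase_self,
        smul_smul, orientationSign_mul_self, one_smul, Finset.insert_erase hw]
    · intro v hv hvw
      rw [map_smul, cone_single, if_pos (Finset.mem_erase.2 ⟨hvw.symm, hw⟩), smul_zero]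
  · rw [if_neg hw, map_smul, boundary_single_one, boundary_single_one, Finset.sum_insert hw,
      Finset.erase_insert hw, smul_add, smul_smul, orientationSign_insert_self,
      orientationSign_mul_self, one_smul, add_assoc, map_sum, Finset.smul_sum,
      ← Finset.sum_add_distrib, Finset.sum_eq_zero, add_zero]
    intro v hv
    have hvw : v ≠ w := by rintro rfl; exact hw hv
    rw [map_smul, cone_single, if_neg (fun h => hw (Finset.mem_of_mem_erase h)), smul_smul,
      smul_smul, mul_comm (orientationSign k w s), orientationSign_insert_mul k hv hw,
      Finset.erase_insert_of_ne hvw.symm, neg_smul, mul_comm (orientationSign k v s),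
      neg_add_cancel]

theorem boundary_cone (w : V) (x : Finset V →₀ k) :
    boundary k (cone k w x) = x - cone k w (boundary k x) :=
  eq_sub_of_add_eq (boundary_cone_add_cone_boundary k w x)

/-- The link operator at `w`: the left inverse of `cone k w` on chains avoiding `w`. -/
def link (w : V) : (Finset V →₀ k) →ₗ[k] (Finset V →₀ k) :=
  Finsupp.lsum k fun s : Finset V =>
    if w ∈ s then orientationSign k w s • Finsupp.lsingle (s.erase w) else 0

theorem link_single (w : V) (s : Finset V) :
    link k w (Finsupp.single s 1) =
      if w ∈ s then orientationSign k w s • Finsupp.single (s.erase w) (1 : k) else 0 := by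
  unfold link
  rw [Finsupp.lsum_single]
  split_ifs <;> simp

end Cone

/-! ### Dimension counts for subspaces. -/

section Rank

variable {k : Type*} [Field k] {E F : Type*} [AddCommGroup E] [Module k E] [AddCommGroup F]
  [Module k F]

theorem finrank_map_add_finrank_inf_ker [Module.Finite k E] (Z : Submodule k E) (g : E →ₗ[k] F) :
    Module.finrank k (Z.map g) + Module.finrank k (Z ⊓ LinearMap.ker g : Submodule k E) =
      Module.finrank k Z := by
  rw [← LinearMap.finrank_range_add_finrank_ker (g.domRestrict Z), LinearMap.range_domRestrict,
    LinearMap.ker_domRestrict, ← Submodule.finrank_map_subtype_eq Z,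
    Submodule.map_comap_subtype]

/-- If `Z` is spanned modulo `D` by a finite family, and `Z ⊓ D ≤ B`, then the dimension of `Z`
exceeds that of `B` by at most the size of the family. -/
theorem finrank_le_of_span_range [Module.Finite k E] {Z B D : Submodule k E} {ι : Type*} [Fintype ι]
    (x : ι → E) (hZ : Z ≤ D ⊔ Submodule.span k (Set.range x)) (hB : Z ⊓ D ≤ B) :
    Module.finrank k Z ≤ Module.finrank k B + Fintype.card ι := by
  rw [← finrank_map_add_finrank_inf_ker Z D.mkQ, Submodule.ker_mkQ, add_comm]
  refine add_le_add (Submodule.finrank_mono hB) ?_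
  have h : Z.map D.mkQ ≤ Submodule.span k (Set.range (D.mkQ ∘ x)) := by
    refine (Submodule.map_mono hZ).trans ?_
    rw [Submodule.map_sup, Submodule.map_span, ← Set.range_comp, Submodule.mkQ_map_self, bot_sup_eq]
  exact (Submodule.finrank_mono h).trans (finrank_range_le_card _)

/-- The quotient of `Z` by the part that `f` sends into `B'` embeds in the quotient of `Z'` by `B'`,
of dimension at most `N`. -/
theorem finrank_le_of_map_le [Module.Finite k E] [Module.Finite k F] {Z : Submodule k E}
    {Z' B' : Submodule k F} {N : ℕ} (f : E →ₗ[k] F) (hf : Z.map f ≤ Z') (hB : B' ≤ Z')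
    (hN : Module.finrank k Z' ≤ Module.finrank k B' + N) :
    Module.finrank k Z ≤ Module.finrank k (Z ⊓ B'.comap f : Submodule k E) + N := by
  have h1 := finrank_map_add_finrank_inf_ker Z (B'.mkQ ∘ₗ f)
  have h2 := finrank_map_add_finrank_inf_ker Z' B'.mkQ
  rw [Submodule.ker_mkQ, inf_eq_right.2 hB] at h2
  rw [LinearMap.ker_comp, Submodule.ker_mkQ, Submodule.map_comp] at h1
  have h3 := Submodule.finrank_mono (Submodule.map_mono (f := B'.mkQ) hf)
  omega

end Rank

/-! ### Adding one vertex to a flag complex. -/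

section CliqueChains

variable (k : Type*) [Field k] {V : Type*} (G : SimpleGraph V)

/-- The chains on the cliques of `G` with `m` vertices, all of them in `P`. -/
def cliqueChains (P : Set V) (m : ℕ) : Submodule k (Finset V →₀ k) :=
  Finsupp.supported k k {s : Finset V | G.IsClique (s : Set V) ∧ (s : Set V) ⊆ P ∧ s.card = m}

variable {G}

theorem cliqueChains_le_iff {P : Set V} {m : ℕ} {S : Submodule k (Finset V →₀ k)} :
    cliqueChains k G P m ≤ S ↔ ∀ s : Finset V, G.IsClique (s : Set V) → (s : Set V) ⊆ P →
      s.card = m → Finsupp.single s 1 ∈ S := by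
  rw [cliqueChains, Finsupp.supported_eq_span_single, Submodule.span_le, Set.image_subset_iff]
  exact ⟨fun h s h1 h2 h3 => h ⟨h1, h2, h3⟩, fun h s hs => h s hs.1 hs.2.1 hs.2.2⟩

theorem single_mem_cliqueChains {P : Set V} {s : Finset V} (hs : G.IsClique (s : Set V))
    (hP : (s : Set V) ⊆ P) : Finsupp.single s 1 ∈ cliqueChains k G P s.card :=
  Finsupp.single_mem_supported k _ ⟨hs, hP, rfl⟩

theorem cliqueChains_mono {P Q : Set V} (h : P ⊆ Q) (m : ℕ) :
    cliqueChains k G P m ≤ cliqueChains k G Q m :=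
  Finsupp.supported_mono fun _ hs => ⟨hs.1, hs.2.1.trans h, hs.2.2⟩

variable [LinearOrder V]

variable (G) in
/-- The cycles on cliques with `m` vertices in `P`. -/
def cliqueCycles (P : Set V) (m : ℕ) : Submodule k (Finset V →₀ k) :=
  cliqueChains k G P m ⊓ LinearMap.ker (boundary k)

variable (G) in
/-- The boundaries on cliques with `m` vertices in `P`. -/
def cliqueBoundaries (P : Set V) (m : ℕ) : Submodule k (Finset V →₀ k) :=
  (cliqueChains k G P (m + 1)).map (boundary k)

theorem cliqueBoundaries_mono {P Q : Set V} (h : P ⊆ Q) (m : ℕ) :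
    cliqueBoundaries k G P m ≤ cliqueBoundaries k G Q m :=
  Submodule.map_mono (cliqueChains_mono k h _)

theorem cliqueBoundaries_le_cliqueCycles (P : Set V) (m : ℕ) :
    cliqueBoundaries k G P m ≤ cliqueCycles k G P m := by
  rw [cliqueBoundaries, Submodule.map_le_iff_le_comap, cliqueChains_le_iff]
  intro s hs hP hm
  refine Submodule.mem_inf.2 ⟨?_, boundary_boundary k _⟩
  rw [boundary_single_one]
  refine Submodule.sum_mem _ fun v hv => Submodule.smul_mem _ _ ?_
  have hc : (s.erase v).card = m := by rw [Finset.card_erase_of_mem hv, hm]; rfl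
  rw [← hc]
  have hsub : ((s.erase v : Finset V) : Set V) ⊆ s := by simp
  exact single_mem_cliqueChains k (hs.subset hsub) (hsub.trans hP)

variable (G) in
/-- The neighbours of `w` that precede it. -/
def lowerNeighbors (w : V) : Set V := {x | x < w ∧ G.Adj w x}

theorem cone_mem_cliqueChains {w : V} {m : ℕ} {x : Finset V →₀ k}
    (hx : x ∈ cliqueChains k G (lowerNeighbors G w) m) :
    cone k w x ∈ cliqueChains k G (Set.Iic w) (m + 1) := by
  refine ((cliqueChains_le_iff k (S := (cliqueChains k G (Set.Iic w) (m + 1)).comap (cone k w))).2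
    fun s hs hP hm => ?_) hx
  rw [Submodule.mem_comap, cone_single]
  split_ifs with hw
  · exact Submodule.zero_mem _
  · refine Submodule.smul_mem _ _ ?_
    rw [← hm, ← Finset.card_insert_of_notMem hw]
    refine single_mem_cliqueChains k ?_ ?_
    · rw [Finset.coe_insert, SimpleGraph.isClique_insert]
      exact ⟨hs, fun b hb _ => (hP hb).2⟩
    · rw [Finset.coe_insert]
      exact Set.insert_subset le_rfl fun b hb => (hP hb).1.le

theorem link_cone {w : V} {m : ℕ} {x : Finset V →₀ k}
    (hx : x ∈ cliqueChains k G (Set.Iio w) m) : link k w (cone k w x) = x := by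
  refine ((cliqueChains_le_iff k (S := LinearMap.eqLocus (link k w ∘ₗ cone k w) LinearMap.id)).2
    fun s hs hP hm => ?_) hx
  have hw : w ∉ s := fun h => lt_irrefl w (hP h)
  rw [LinearMap.mem_eqLocus, LinearMap.comp_apply, cone_single, if_neg hw, map_smul, link_single,
    if_pos (Finset.mem_insert_self _ _), smul_smul, orientationSign_insert_self,
    orientationSign_mul_self, one_smul, Finset.erase_insert hw, LinearMap.id_apply]

theorem link_eq_zero {w : V} {m : ℕ} {x : Finset V →₀ k}
    (hx : x ∈ cliqueChains k G (Set.Iio w) m) : link k w x = 0 := by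
  refine ((cliqueChains_le_iff k (S := LinearMap.ker (link k w))).2 fun s hs hP hm => ?_) hx
  have hw : w ∉ s := fun h => lt_irrefl w (hP h)
  rw [LinearMap.mem_ker, link_single, if_neg hw]

theorem link_mem_cliqueChains {w : V} {m : ℕ} {x : Finset V →₀ k}
    (hx : x ∈ cliqueChains k G (Set.Iic w) (m + 1)) :
    link k w x ∈ cliqueChains k G (lowerNeighbors G w) m := by
  refine ((cliqueChains_le_iff k
    (S := (cliqueChains k G (lowerNeighbors G w) m).comap (link k w))).2 fun s hs hP hm => ?_) hx
  rw [Submodule.mem_comap, link_single]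
  split_ifs with hw
  · refine Submodule.smul_mem _ _ ?_
    have hc : (s.erase w).card = m := by rw [Finset.card_erase_of_mem hw, hm]; rfl
    rw [← hc]
    refine single_mem_cliqueChains k (hs.subset (by simp)) fun x hx => ?_
    rw [Finset.mem_coe, Finset.mem_erase] at hx
    exact ⟨lt_of_le_of_ne (hP hx.2) hx.1, hs hw hx.2 hx.1.symm⟩
  · exact Submodule.zero_mem _

/-- A chain splits into the cone over its link and a part avoiding `w`; the Mayer–Vietoris step
below rests on this splitting. -/
theorem sub_cone_link_mem {w : V} {m : ℕ} {x : Finset V →₀ k}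
    (hx : x ∈ cliqueChains k G (Set.Iic w) m) :
    x - cone k w (link k w x) ∈ cliqueChains k G (Set.Iio w) m := by
  refine ((cliqueChains_le_iff k (S := (cliqueChains k G (Set.Iio w) m).comap
    (LinearMap.id - cone k w ∘ₗ link k w))).2 fun s hs hP hm => ?_) hx
  rw [Submodule.mem_comap, LinearMap.sub_apply, LinearMap.comp_apply, link_single,
    LinearMap.id_apply]
  split_ifs with hw
  · rw [map_smul, cone_single, if_neg (Finset.notMem_erase w s), smul_smul,
      orientationSign_erase_self, orientationSign_mul_self, one_smul, Finset.insert_erase hw,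
      sub_self]
    exact Submodule.zero_mem _
  · rw [map_zero, sub_zero, ← hm]
    exact single_mem_cliqueChains k hs fun y hy =>
      lt_of_le_of_ne (hP hy) (by rintro rfl; exact hw hy)

/-- Adding a last vertex `w` to a flag complex raises the Betti number by at most the Betti number,
one degree lower, of the link of `w`. -/
theorem finrank_cliqueCycles_Iic_le [Fintype V] {w : V} {m N N' : ℕ}
    (hlink : Module.finrank k (cliqueCycles k G (lowerNeighbors G w) m) ≤
      Module.finrank k (cliqueBoundaries k G (lowerNeighbors G w) m) + N')
    (hlow : Module.finrank k (cliqueCycles k G (Set.Iio w) (m + 1)) ≤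
      Module.finrank k (cliqueBoundaries k G (Set.Iio w) (m + 1)) + N) :
    Module.finrank k (cliqueCycles k G (Set.Iic w) (m + 1)) ≤
      Module.finrank k (cliqueBoundaries k G (Set.Iic w) (m + 1)) + (N' + N) := by
  have hsub : lowerNeighbors G w ⊆ Set.Iio w := fun x hx => hx.1
  have h1 := finrank_le_of_map_le (Z := cliqueCycles k G (Set.Iic w) (m + 1)) (link k w)
    (B' := cliqueBoundaries k G (lowerNeighbors G w) m) ?_
    (cliqueBoundaries_le_cliqueCycles k _ m) hlink
  · have h2 : cliqueCycles k G (Set.Iic w) (m + 1) ⊓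
        (cliqueBoundaries k G (lowerNeighbors G w) m).comap (link k w) ≤
        cliqueBoundaries k G (Set.Iic w) (m + 1) ⊔ cliqueCycles k G (Set.Iio w) (m + 1) := by
      rintro z ⟨⟨hz, hz0⟩, y, hy, hyz⟩
      have hb := sub_cone_link_mem k hz
      have hcy : boundary k (cone k w y) ∈ cliqueBoundaries k G (Set.Iic w) (m + 1) :=
        Submodule.mem_map_of_mem (cone_mem_cliqueChains k hy)
      rw [← neg_add_cancel_left (boundary k (cone k w y)) z]
      refine Submodule.add_mem_sup (Submodule.neg_mem _ hcy) (Submodule.mem_inf.2 ⟨?_, ?_⟩)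
      · rw [boundary_cone, hyz, sub_add_eq_add_sub, add_sub_assoc]
        exact Submodule.add_mem _ (cliqueChains_mono k hsub _ hy) hb
      · rw [LinearMap.mem_ker, map_add, boundary_boundary, zero_add]; exact hz0
    have h3 := Submodule.finrank_mono h2
    have h4 := Submodule.finrank_sup_add_finrank_inf_eq
      (cliqueBoundaries k G (Set.Iic w) (m + 1)) (cliqueCycles k G (Set.Iio w) (m + 1))
    have h5 : Module.finrank k (cliqueBoundaries k G (Set.Iio w) (m + 1)) ≤ _ :=
      Submodule.finrank_mono (le_inf (cliqueBoundaries_mono k Set.Iio_subset_Iic_self (m + 1))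
        (cliqueBoundaries_le_cliqueCycles k (Set.Iio w) (m + 1)))
    omega
  -- The link `l` of a cycle is a cycle: with `z = cone l + b`, the equation `∂z = 0` reads `∂b =
  -- cone (∂l) - l`. The link operator kills `∂b` and `l` and returns `∂l` from its cone, so `∂l =
  -- 0`. For `m = 0`, `l` is a multiple of the empty simplex.
  · rw [Submodule.map_le_iff_le_comap]
    rintro z ⟨hz, hz0⟩
    refine Submodule.mem_inf.2 ⟨link_mem_cliqueChains k hz, ?_⟩
    have hl := link_mem_cliqueChains k hz
    rw [LinearMap.mem_ker]
    replace hz0 : boundary k z = 0 := hz0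
    cases m with
    | zero =>
      refine (LinearMap.mem_ker (f := boundary k)).1 ((cliqueChains_le_iff k).2 ?_ hl)
      intro s _ _ hs
      rw [LinearMap.mem_ker, Finset.card_eq_zero.1 hs, boundary_single_one, Finset.sum_empty]
    | succ m =>
    have hd : ∀ {P : Set V} {n : ℕ} {x}, x ∈ cliqueChains k G P (n + 1) →
        boundary k x ∈ cliqueChains k G P n := fun hx =>
      (cliqueBoundaries_le_cliqueCycles k _ _ (Submodule.mem_map_of_mem hx)).1
    have e1 := hd (sub_cone_link_mem k hz)
    rw [map_sub, hz0, zero_sub, boundary_cone, neg_sub] at e1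
    have e2 := link_eq_zero k e1
    rwa [map_sub, link_cone k (cliqueChains_mono k hsub _ (hd hl)),
      link_eq_zero k (cliqueChains_mono k hsub _ hl), sub_zero] at e2

end CliqueChains

/-! ### First Betti number when each colour class is a clique. -/

section Link

variable (k : Type*) [Field k] {V : Type*} [LinearOrder V] {G : SimpleGraph V}

/-- Modulo boundaries, each side of a triangle is a combination of the two others. -/
theorem single_pair_mem_of_triangle {P : Set V} {S : Submodule k (Finset V →₀ k)}
    (hS : cliqueBoundaries k G P 2 ≤ S) {x y z : V} (hx : x ∈ P) (hy : y ∈ P) (hz : z ∈ P)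
    (hxy : G.Adj x y) (hxz : G.Adj x z) (hyz : G.Adj y z)
    (h1 : Finsupp.single {x, z} 1 ∈ S) (h2 : Finsupp.single {y, z} 1 ∈ S) :
    Finsupp.single {x, y} 1 ∈ S := by
  have hcl : G.IsClique (({x, y, z} : Finset V) : Set V) := by
    simp [SimpleGraph.isClique_insert, hxy, hxz, hyz]
  have hP : (({x, y, z} : Finset V) : Set V) ⊆ P := by
    simp [Set.insert_subset_iff, hx, hy, hz]
  have hcard : ({x, y, z} : Finset V).card = 3 :=
    Finset.card_eq_three.2 ⟨x, y, z, hxy.ne, hxz.ne, hyz.ne, rfl⟩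
  have hm := single_mem_cliqueChains k hcl hP
  rw [hcard] at hm
  have hb := hS (Submodule.mem_map_of_mem hm)
  rw [boundary_single_one, Finset.sum_insert (by simp [hxy.ne, hxz.ne]),
    Finset.sum_insert (by simp [hyz.ne]), Finset.sum_singleton] at hb
  have e1 : ({x, y, z} : Finset V).erase x = {y, z} :=
    Finset.erase_insert (by simp [hxy.ne, hxz.ne])
  have e2 : ({x, y, z} : Finset V).erase y = {x, z} := by
    rw [Finset.insert_comm]
    exact Finset.erase_insert (by simp [hxy.ne.symm, hyz.ne])
  have e3 : ({x, y, z} : Finset V).erase z = {x, y} := by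
    rw [Finset.pair_comm y z, Finset.insert_comm]
    exact Finset.erase_insert (by simp [hxz.ne.symm, hyz.ne.symm])
  rw [e1, e2, e3] at hb
  have h3 := (Submodule.add_mem_iff_right S (Submodule.smul_mem _ _ h2)).1 hb
  have h4 := (Submodule.add_mem_iff_right S (Submodule.smul_mem _ _ h1)).1 h3
  exact (Submodule.smul_mem_iff S (orientationSign_ne_zero k _ _)).1 h4

end Link

/-- A representative in `P` of each colour occurring in `P`. -/
theorem exists_colour_base {V κ : Type*} (col : V → κ) (P : Set V) : ∃ b : V → V, ∀ x ∈ P, b x ∈ P ∧ col (b x) = col x ∧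
    ∀ y ∈ P, col x = col y → b x = b y := by
  classical
  refine ⟨fun x => if h : ∃ y ∈ P, col y = col x then h.choose else x, fun x hx => ?_⟩
  have h : ∃ y ∈ P, col y = col x := ⟨x, hx, rfl⟩
  refine ⟨?_, ?_, fun y hy hxy => ?_⟩
  · simp only [dif_pos h]; exact h.choose_spec.1
  · simp only [dif_pos h]; exact h.choose_spec.2
  · simp only [hxy]
    rw [dif_pos ⟨y, hy, rfl⟩, dif_pos ⟨y, hy, rfl⟩]

section Link

variable (k : Type*) [Field k] {V : Type*} [LinearOrder V] {G : SimpleGraph V} {κ : Type*}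

/-- The edges that join a vertex of `P` to the base point of its colour. -/
def starEdges (P : Set V) (b : V → V) : Set (Finset V) :=
  {e | ∃ x ∈ P, b x ≠ x ∧ e = {b x, x}}

variable {col : V → κ}

/-- The star edges form a forest of stars. A vertex `x` that is not a base point lies on only one of
them, so up to sign the coefficient of `{x}` in the boundary is the coefficient of that edge. -/
theorem eq_zero_of_boundary_eq_zero_of_star {P : Set V} {b : V → V}
    (hb : ∀ x ∈ P, b x ∈ P ∧ col (b x) = col x ∧ ∀ y ∈ P, col x = col y → b x = b y)
    {a : Finset V →₀ k} (ha : a ∈ Finsupp.supported k k (starEdges P b))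
    (h0 : boundary k a = 0) : a = 0 := by
  ext e
  by_cases he : e ∈ starEdges P b
  swap
  · exact Finsupp.notMem_support_iff.1 fun h => he (ha h)
  obtain ⟨x, hx, hbx, rfl⟩ := he
  have key : Finsupp.supported k k (starEdges P b) ≤
      LinearMap.eqLocus (Finsupp.lapply {x} ∘ₗ boundary k)
        (orientationSign k (b x) {b x, x} • Finsupp.lapply {b x, x}) := by
    rw [Finsupp.supported_eq_span_single, Submodule.span_le]
    rintro _ ⟨_, ⟨y, hy, hby, rfl⟩, rfl⟩
    have hbyx : b y ≠ x := by
      rintro rfl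
      exact hbx ((hb _ hx).2.2 y hy (hb y hy).2.1)
    rw [SetLike.mem_coe, LinearMap.mem_eqLocus, LinearMap.comp_apply, boundary_single_one,
      Finset.sum_pair hby, Finset.erase_insert (by simpa using hby), Finset.pair_comm,
      Finset.erase_insert (by simpa using hby.symm)]
    rw [Finset.pair_comm]
    have h1 : ({b y} : Finset V) ≠ {x} := by simpa using hbyx
    rcases eq_or_ne y x with rfl | hyx
    · simp [Finsupp.single_eq_of_ne' h1]
    · have h2 : ({y} : Finset V) ≠ {x} := by simpa using hyx
      have h3 : ({b y, y} : Finset V) ≠ {b x, x} := by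
        intro h
        have : x ∈ ({b y, y} : Finset V) := by rw [h]; simp
        simp [hbyx.symm, hyx.symm] at this
      simp [Finsupp.single_eq_of_ne' h1, Finsupp.single_eq_of_ne' h2,
        Finsupp.single_eq_of_ne' h3]
  have h := key ha
  rw [LinearMap.mem_eqLocus, LinearMap.comp_apply, h0, map_zero, LinearMap.smul_apply] at h
  exact (smul_eq_zero.1 h.symm).resolve_left (orientationSign_ne_zero k _ _)

variable (G) in
/-- The boundaries of triangles in `P` together with the star edges. -/
def triangleStarSpan (P : Set V) (b : V → V) : Submodule k (Finset V →₀ k) :=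
  cliqueBoundaries k G P 2 ⊔ Finsupp.supported k k (starEdges P b)

theorem cliqueCycles_inf_triangleStarSpan_le {P : Set V} {b : V → V}
    (hb : ∀ x ∈ P, b x ∈ P ∧ col (b x) = col x ∧ ∀ y ∈ P, col x = col y → b x = b y) :
    cliqueCycles k G P 2 ⊓ triangleStarSpan k G P b ≤ cliqueBoundaries k G P 2 := by
  rintro z ⟨hz, hz'⟩
  obtain ⟨y, hy, a, ha, rfl⟩ := Submodule.mem_sup.1 hz'
  have hy0 := (Submodule.mem_inf.1 (cliqueBoundaries_le_cliqueCycles k P 2 hy)).2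
  have hz0 := (Submodule.mem_inf.1 hz).2
  rw [LinearMap.mem_ker] at hy0 hz0
  rw [map_add, hy0, zero_add] at hz0
  rwa [eq_zero_of_boundary_eq_zero_of_star k hb ha hz0, add_zero]

/-- The triangle with the common base point expresses the edge through two star edges, unless an
endpoint is the base point and the edge is itself a star edge. -/
theorem single_pair_mem_triangleStarSpan {P : Set V} {b : V → V}
    (hb : ∀ x ∈ P, b x ∈ P ∧ col (b x) = col x ∧ ∀ y ∈ P, col x = col y → b x = b y)
    (hP : ∀ x ∈ P, ∀ y ∈ P, x ≠ y → col x = col y → G.Adj x y)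
    {x y : V} (hx : x ∈ P) (hy : y ∈ P) (hxy : x ≠ y) (hc : col x = col y) :
    Finsupp.single {x, y} 1 ∈ triangleStarSpan k G P b := by
  have star : ∀ z ∈ P, b z ≠ z → Finsupp.single {z, b z} 1 ∈ triangleStarSpan k G P b :=
    fun z hz hbz => Submodule.mem_sup_right (Finsupp.single_mem_supported k _
      ⟨z, hz, hbz, Finset.pair_comm _ _⟩)
  have hbb := (hb x hx).2.2 y hy hc
  by_cases h1 : b x = x
  · have h2 := star y hy (by rw [← hbb, h1]; exact hxy)
    rwa [← hbb, h1, Finset.pair_comm] at h2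
  by_cases h2 : b y = y
  · have h3 := star x hx h1
    rwa [hbb, h2] at h3
  have h3 := star y hy h2
  rw [← hbb] at h3
  have hbP := (hb x hx).1
  have hbc := (hb x hx).2.1
  exact single_pair_mem_of_triangle k le_sup_left hx hy hbP (hP x hx y hy hxy hc)
    (hP x hx _ hbP (Ne.symm h1) hbc.symm) (hP y hy _ hbP (by rw [hbb]; exact Ne.symm h2)
      (hc.symm.trans hbc.symm)) (star x hx h1) h3

/-- Let `P` be a vertex set in which vertices of the same colour are adjacent. Given edges `T` that
span all edges in `P` up to triangles and edges inside a colour, some of them bound the first Betti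
number of `P`, and are independent: no two of the same colours are at distance at most one. -/
theorem exists_independent_edges [Fintype V] {P : Set V} {b : V → V}
    (hb : ∀ x ∈ P, b x ∈ P ∧ col (b x) = col x ∧ ∀ y ∈ P, col x = col y → b x = b y)
    (hP : ∀ x ∈ P, ∀ y ∈ P, x ≠ y → col x = col y → G.Adj x y) (T : Set (Finset V))
    (hT : cliqueChains k G P 2 ≤ triangleStarSpan k G P b ⊔
      Submodule.span k ((fun e => Finsupp.single e 1) '' T)) :
    ∃ R : Finset (Finset V), (R : Set (Finset V)) ⊆ T ∧
      Module.finrank k (cliqueCycles k G P 2) ≤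
        Module.finrank k (cliqueBoundaries k G P 2) + R.card ∧
      (∀ x ∈ P, ∀ y ∈ P, x ≠ y → col x = col y → {x, y} ∉ R) ∧
      ∀ u ∈ P, ∀ u' ∈ P, ∀ v ∈ P, ∀ v' ∈ P, col u = col u' → col v = col v' → G.Adj u v →
        G.Adj u' v' → G.Adj u v' → {u, v} ∈ R → {u', v'} ∈ R → ({u, v} : Finset V) = {u', v'} := by
  classical
  set D := triangleStarSpan k G P b with hD
  -- `T` is thinned to a family that is a basis, modulo `D`, of the span of `T`.
  obtain ⟨ι, f, hf, hspan, hli⟩ := exists_linearIndependent' k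
    (fun e : T => D.mkQ (Finsupp.single (e : Finset V) (1 : k)))
  have : Fintype ι := Fintype.ofInjective f hf
  have hinj : Function.Injective fun i => ((f i : T) : Finset V) := Subtype.val_injective.comp hf
  refine ⟨Finset.univ.map ⟨_, hinj⟩, ?_, ?_, ?_, ?_⟩
  · rintro _ he
    obtain ⟨i, -, rfl⟩ := Finset.mem_map.1 he
    exact (f i).2
  · rw [Finset.card_map, Finset.card_univ]
    refine finrank_le_of_span_range (D := D)
      (fun i => Finsupp.single ((f i : T) : Finset V) (1 : k)) ?_
      (cliqueCycles_inf_triangleStarSpan_le k hb)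
    refine (inf_le_left.trans hT).trans (sup_le le_sup_left ?_)
    have h1 : (Submodule.span k ((fun e => Finsupp.single e (1 : k)) '' T)).map D.mkQ ≤
        (Submodule.span k (Set.range fun i =>
          Finsupp.single ((f i : T) : Finset V) (1 : k))).map D.mkQ := by
      rw [Submodule.map_span, Submodule.map_span, ← Set.range_comp, Set.image_image,
        Set.image_eq_range]
      exact hspan.ge
    have h2 := Submodule.map_le_iff_le_comap.1 h1
    rwa [Submodule.comap_map_eq, Submodule.ker_mkQ, sup_comm] at h2
  · intro x hx y hy hxy hc he
    obtain ⟨i, -, hi⟩ := Finset.mem_map.1 he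
    refine hli.ne_zero i ?_
    change D.mkQ (Finsupp.single ((f i : T) : Finset V) 1) = 0
    change ((f i : T) : Finset V) = {x, y} at hi
    rw [hi, Submodule.mkQ_apply, Submodule.Quotient.mk_eq_zero]
    exact single_pair_mem_triangleStarSpan k hb hP hx hy hxy hc
  · intro u hu u' hu' v hv v' hv' hcu hcv huv huv' hadj he he'
    obtain ⟨i, -, hi⟩ := Finset.mem_map.1 he
    obtain ⟨j, -, hj⟩ := Finset.mem_map.1 he'
    by_contra hne
    have hij : i ≠ j := by rintro rfl; exact hne (hi.symm.trans hj)
    -- Modulo `D`, the triangle `u u' v'` makes `uv'` a multiple of `u'v'`, and the triangle `u v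
    -- v'` makes `uv` a multiple of `uv'`. Two distinct members of the independent family would thus
    -- be proportional.
    set S := D ⊔ Submodule.span k {Finsupp.single ({u', v'} : Finset V) (1 : k)} with hS
    have hDS : D ≤ S := le_sup_left
    have hBS : cliqueBoundaries k G P 2 ≤ S := le_sup_left.trans hDS
    have h0 : Finsupp.single {u', v'} 1 ∈ S :=
      Submodule.mem_sup_right (Submodule.mem_span_singleton_self _)
    have h1 : Finsupp.single {u, v'} 1 ∈ S := by
      rcases eq_or_ne u u' with rfl | huu
      · exact h0
      · refine single_pair_mem_of_triangle k hBS hu hv' hu' hadj (hP u hu u' hu' huu hcu)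
          huv'.symm (hDS (single_pair_mem_triangleStarSpan k hb hP hu hu' huu hcu)) ?_
        rwa [Finset.pair_comm]
    have h2 : Finsupp.single {u, v} 1 ∈ S := by
      rcases eq_or_ne v v' with rfl | hvv
      · exact h1
      · exact single_pair_mem_of_triangle k hBS hu hv hv' huv hadj (hP v hv v' hv' hvv hcv)
          h1 (hDS (single_pair_mem_triangleStarSpan k hb hP hv hv' hvv hcv))
    obtain ⟨d, hd, c, hc, hdc⟩ := Submodule.mem_sup.1 h2
    obtain ⟨r, rfl⟩ := Submodule.mem_span_singleton.1 hc
    have h3 := congrArg D.mkQ hdc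
    rw [map_add, map_smul, Submodule.mkQ_apply, (Submodule.Quotient.mk_eq_zero D).2 hd,
      zero_add] at h3
    change ((f i : T) : Finset V) = {u, v} at hi
    change ((f j : T) : Finset V) = {u', v'} at hj
    rw [← hi, ← hj] at h3
    refine hli.notMem_span_image (s := {j}) (x := i) hij ?_
    rw [Set.image_singleton]
    exact Submodule.mem_span_singleton.2 ⟨r, h3⟩

end Link

/-! ### Edges charged to each vertex. -/

section NewEdges

variable (k : Type*) [Field k] {V : Type*} [LinearOrder V] {G : SimpleGraph V} {κ : Type*}
  {col : V → κ}

variable (G col) in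
/-- The edges among the lower neighbours of `w` that do not lie among the lower neighbours of an
earlier vertex of the colour of `w`. -/
def newEdges (w : V) : Set (Finset V) :=
  {e | (e : Set V) ⊆ lowerNeighbors G w ∧ G.IsClique (e : Set V) ∧ e.card = 2 ∧
    ∀ w' < w, col w' = col w → ¬ (e : Set V) ⊆ lowerNeighbors G w'}

/-- An edge `uv` that is not new lies among the lower neighbours of an earlier `w'` of the colour of
`w`. Since `w` and `w'` share the neighbour `u`, they are adjacent, so `w'` lies in the same link
and `uv` can be traded for `uw'` and `vw'`. Their larger endpoint `w'` exceeds both `u` and `v`, so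
the induction runs down from the top vertex. -/
theorem cliqueChains_le_span_newEdges [Finite V]
    (hcol : ∀ u v w, u ≠ v → col u = col v → G.Adj w u → G.Adj w v → G.Adj u v) (w : V)
    (b : V → V) :
    cliqueChains k G (lowerNeighbors G w) 2 ≤ triangleStarSpan k G (lowerNeighbors G w) b ⊔
      Submodule.span k ((fun e => Finsupp.single e 1) '' newEdges G col w) := by
  set S := triangleStarSpan k G (lowerNeighbors G w) b ⊔
      Submodule.span k ((fun e => Finsupp.single e (1 : k)) '' newEdges G col w) with hS
  have hBS : cliqueBoundaries k G (lowerNeighbors G w) 2 ≤ S := le_sup_left.trans le_sup_left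
  have key : ∀ v u, u < v → u ∈ lowerNeighbors G w → v ∈ lowerNeighbors G w → G.Adj u v →
      Finsupp.single {u, v} 1 ∈ S := by
    intro v
    induction v using WellFoundedGT.induction with
    | ind v ih =>
    intro u huv hu hv hadj
    by_cases hnew : {u, v} ∈ newEdges G col w
    · exact Submodule.mem_sup_right (Submodule.subset_span ⟨_, hnew, rfl⟩)
    · have h : ∃ w' < w, col w' = col w ∧ u ∈ lowerNeighbors G w' ∧ v ∈ lowerNeighbors G w' := by
        by_contra! hcon
        refine hnew ⟨?_, ?_, Finset.card_pair huv.ne, fun w' hw' hc hsub => ?_⟩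
        · simp [Set.insert_subset_iff, hu, hv]
        · simp [SimpleGraph.isClique_insert, hadj]
        · exact hcon w' hw' hc (hsub (by simp)) (hsub (by simp))
      obtain ⟨w', hw', hc, hu', hv'⟩ := h
      have hw'w : w' ∈ lowerNeighbors G w :=
        ⟨hw', hcol w w' u hw'.ne' hc.symm hu.2.symm hu'.2.symm⟩
      exact single_pair_mem_of_triangle k hBS hu hv hw'w hadj hu'.2.symm hv'.2.symm
        (ih w' hv'.1 u hu'.1 hu hw'w hu'.2.symm) (ih w' hv'.1 v hv'.1 hv hw'w hv'.2.symm)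
  rw [cliqueChains_le_iff]
  intro s hs hsP hcard
  obtain ⟨x, y, hxy, rfl⟩ := Finset.card_eq_two.1 hcard
  have hx := hsP (show x ∈ (({x, y} : Finset V) : Set V) by simp)
  have hy := hsP (show y ∈ (({x, y} : Finset V) : Set V) by simp)
  have hadj : G.Adj x y := hs (by simp) (by simp) hxy
  rcases lt_or_gt_of_ne hxy with h | h
  · exact key y x h hx hy hadj
  · rw [Finset.pair_comm]
    exact key x y h hy hx hadj.symm

/-- The second Betti number of a flag complex is bounded by a family of sets of edges which, for
vertices of the same colour, are disjoint, and each of which is independent. -/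
theorem exists_newEdges_family [Fintype V]
    (hcol : ∀ u v w, u ≠ v → col u = col v → G.Adj w u → G.Adj w v → G.Adj u v) :
    ∃ R : V → Finset (Finset V), (∀ w, (R w : Set (Finset V)) ⊆ newEdges G col w) ∧
      Module.finrank k (cliqueCycles k G Set.univ 3) ≤
        Module.finrank k (cliqueBoundaries k G Set.univ 3) + ∑ w, (R w).card ∧
      (∀ w, ∀ x y, x ≠ y → col x = col y → {x, y} ∉ R w) ∧
      ∀ w, ∀ u u' v v', col u = col u' → col v = col v' → G.Adj u v' → {u, v} ∈ R w →
        {u', v'} ∈ R w → ({u, v} : Finset V) = {u', v'} := by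
  have hR : ∀ w, ∃ R : Finset (Finset V), (R : Set (Finset V)) ⊆ newEdges G col w ∧
      Module.finrank k (cliqueCycles k G (lowerNeighbors G w) 2) ≤
        Module.finrank k (cliqueBoundaries k G (lowerNeighbors G w) 2) + R.card ∧
      (∀ x y, x ≠ y → col x = col y → {x, y} ∉ R) ∧
      ∀ u u' v v', col u = col u' → col v = col v' → G.Adj u v' → {u, v} ∈ R →
        {u', v'} ∈ R → ({u, v} : Finset V) = {u', v'} := by
    intro w
    obtain ⟨b, hb⟩ := exists_colour_base col (lowerNeighbors G w)
    obtain ⟨R, h1, h2, h3, h4⟩ := exists_independent_edges k hb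
      (fun x hx y hy hxy hc => hcol x y w hxy hc hx.2 hy.2) (newEdges G col w)
      (cliqueChains_le_span_newEdges k hcol w b)
    have hmem : ∀ {x y : V}, {x, y} ∈ R →
        x ∈ lowerNeighbors G w ∧ y ∈ lowerNeighbors G w ∧ G.Adj x y := by
      intro x y h
      obtain ⟨hsub, hcl, hcard, -⟩ := h1 h
      refine ⟨hsub (by simp), hsub (by simp), hcl (by simp) (by simp) ?_⟩
      rintro rfl
      simp at hcard
    refine ⟨R, h1, h2, fun x y hxy hc h => h3 x (hmem h).1 y (hmem h).2.1 hxy hc h, ?_⟩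
    intro u u' v v' hu hv hadj he he'
    obtain ⟨m1, m2, m3⟩ := hmem he
    obtain ⟨m1', m2', m3'⟩ := hmem he'
    exact h4 u m1 u' m1' v m2 v' m2' hu hv m3 m3' hadj he he'
  choose R h1 h2 h3 h4 using hR
  refine ⟨R, h1, ?_, h3, h4⟩
  -- The induction runs over initial segments of the order, adding the maximum each time.
  suffices h : ∀ Q : Finset V, (∀ x ∈ Q, ∀ y ≤ x, y ∈ Q) →
      Module.finrank k (cliqueCycles k G (Q : Set V) 3) ≤
        Module.finrank k (cliqueBoundaries k G (Q : Set V) 3) + ∑ w ∈ Q, (R w).card by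
    have h1 := h Finset.univ (by simp)
    rwa [Finset.coe_univ] at h1
  intro Q
  induction Q using Finset.induction_on_max with
  | empty =>
    intro _
    have : cliqueCycles k G ((∅ : Finset V) : Set V) 3 = ⊥ := by
      rw [eq_bot_iff]
      refine inf_le_left.trans ((cliqueChains_le_iff k).2 fun s _ hs hc => ?_)
      have hs0 : s = ∅ := by simpa using hs
      simp [hs0] at hc
    rw [this, finrank_bot]
    exact Nat.zero_le _
  | insert w Q hQ ih =>
    intro hlow
    have hw : w ∉ Q := fun h => lt_irrefl w (hQ w h)
    have hIio : (Q : Set V) = Set.Iio w := by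
      ext x
      refine ⟨fun h => hQ x h, fun h => ?_⟩
      exact Finset.mem_of_mem_insert_of_ne (hlow w (Finset.mem_insert_self _ _) x (le_of_lt h))
        (ne_of_lt h)
    have hIic : ((insert w Q : Finset V) : Set V) = Set.Iic w := by
      rw [Finset.coe_insert, hIio, Set.Iio_insert]
    have hlow' : ∀ x ∈ Q, ∀ y ≤ x, y ∈ Q := fun x hx y hy => by
      rw [← Finset.mem_coe, hIio] at hx ⊢
      exact lt_of_le_of_lt hy hx
    have hq := ih hlow'
    rw [hIio] at hq
    rw [hIic, Finset.sum_insert hw]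
    exact finrank_cliqueCycles_Iic_le k (h2 w) hq

end NewEdges

/-! ### Flag complexes as clique complexes, and Betti numbers as differences of dimensions. -/

section Betti

variable (k : Type*) [Field k] {V : Type*}

/-- The `1`-skeleton of a simplicial complex. -/
def edgeGraph (K : AbstractSimplicialComplex V) : SimpleGraph V where
  Adj u v := u ≠ v ∧ (open Classical in ({u, v} : Finset V)) ∈ K
  symm := ⟨fun u v h => ⟨h.1.symm, by classical rw [Finset.pair_comm]; exact h.2⟩⟩
  loopless := ⟨fun u h => h.1 rfl⟩

theorem IsFlag.chains_eq {K : AbstractSimplicialComplex V} (hK : IsFlag K) (m : ℕ) :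
    chains k K m = cliqueChains k (edgeGraph K) Set.univ m := by
  unfold chains cliqueChains
  congr 1
  ext s
  refine and_congr ⟨?_, ?_⟩ (by simp)
  · rintro (rfl | hs)
    · simp
    · intro u hu v hv huv
      exact ⟨huv, (K.isRelLowerSet_faces hs).2
        (by simpa [Finset.insert_subset_iff] using ⟨hu, hv⟩) (by simp)⟩
  · intro hs
    rcases s.eq_empty_or_nonempty with h | h
    · exact Or.inl h
    · exact Or.inr (hK s h fun u hu v hv huv => (hs hu hv huv).2)

set_option maxSynthPendingDepth 4 in
theorem finrank_reducedHomology_add [Fintype V] [LinearOrder V] (K : AbstractSimplicialComplex V)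
    (p : ℕ) : Module.finrank k (ReducedHomology k K p) + Module.finrank k (boundaries k K p) =
      Module.finrank k (cycles k K p) := by
  have h := Submodule.finrank_quotient_add_finrank
    ((boundaries k K p).submoduleOf (cycles k K p))
  have e := (Submodule.submoduleOfEquivOfLe (boundaries_le_cycles k K p)).finrank_eq
  exact e ▸ h

end Betti

/-! ### The upper bound: induced matchings from colour classes. -/

section UpperBound

/-- A family of disjoint induced matchings, indexed by any type with at most `n` elements, has
total size at most `I(n)`. -/
theorem sum_card_le_maxInducedMatchings {n : ℕ} {W : Type} (G : SimpleGraph W) (U U' : Finset W)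
    {ι : Type*} [Fintype ι] (M : ι → Finset (Sym2 W)) (hι : Fintype.card ι ≤ n)
    (hG : G.IsBipartiteWith (U : Set W) (U' : Set W))
    (huniv : (U : Set W) ∪ (U' : Set W) = Set.univ) (hU : U.card ≤ n) (hU' : U'.card ≤ n)
    (hM : ∀ i, IsInducedMatching G U U' (M i)) (hd : ∀ i j, i ≠ j → Disjoint (M i) (M j)) :
    ∑ i, (M i).card ≤ maxInducedMatchings n := by
  refine (isGreatest_maxInducedMatchings n).2 ⟨W, G, U, U', Fintype.card ι,
    M ∘ (Fintype.equivFin ι).symm, hG, huniv, hU, hU', hι, fun i => hM _, fun i j hij =>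
      hd _ _ (by simpa using hij), ?_⟩
  exact Equiv.sum_comp (Fintype.equivFin ι).symm fun i => (M i).card

variable {V : Type} [Fintype V] [LinearOrder V] {G : SimpleGraph V} {m : ℕ} {col : V → Fin m}

/-- The edges of `G` between two colours. -/
def colourGraph (G : SimpleGraph V) (col : V → Fin m) (A B : Fin m) : SimpleGraph V where
  Adj x y := G.Adj x y ∧ (col x = A ∧ col y = B ∨ col x = B ∧ col y = A)
  symm := ⟨fun _ _ h => ⟨h.1.symm, h.2.symm.imp And.symm And.symm⟩⟩
  loopless := ⟨fun _ h => h.1.ne rfl⟩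

open Classical in
/-- The edges of a set that join two given colours. -/
def colourMatching (col : V → Fin m) (R : Finset (Finset V)) (A B : Fin m) : Finset (Sym2 V) :=
  Finset.univ.filter fun e => ∃ a b, e = s(a, b) ∧ {a, b} ∈ R ∧ col a = A ∧ col b = B

theorem mk_mem_colourMatching {R : Finset (Finset V)} {A B : Fin m} {u v : V} :
    s(u, v) ∈ colourMatching col R A B ↔
      {u, v} ∈ R ∧ (col u = A ∧ col v = B ∨ col u = B ∧ col v = A) := by
  simp only [colourMatching, Finset.mem_filter, Finset.mem_univ, true_and]
  constructor
  · rintro ⟨a, b, he, hR, ha, hb⟩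
    rcases Sym2.eq_iff.1 he with ⟨rfl, rfl⟩ | ⟨rfl, rfl⟩
    · exact ⟨hR, Or.inl ⟨ha, hb⟩⟩
    · exact ⟨by rwa [Finset.pair_comm], Or.inr ⟨hb, ha⟩⟩
  · rintro ⟨hR, ⟨hu, hv⟩ | ⟨hu, hv⟩⟩
    · exact ⟨u, v, rfl, hR, hu, hv⟩
    · exact ⟨v, u, Sym2.eq_swap, by rwa [Finset.pair_comm], hv, hu⟩

/-- Independence also gives the matching property: if two edges of `R` share a vertex, either of
them serves as the cross edge. The second side is the complement of colour `A`, not just colour `B`,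
because the two sides must exhaust the vertices. -/
theorem isInducedMatching_colourMatching {R : Finset (Finset V)} {A B : Fin m} (hAB : A ≠ B)
    (hadj : ∀ x y, {x, y} ∈ R → G.Adj x y)
    (hR : ∀ u u' v v', col u = col u' → col v = col v' → G.Adj u v' → {u, v} ∈ R →
        {u', v'} ∈ R → ({u, v} : Finset V) = {u', v'}) :
    IsInducedMatching (colourGraph G col A B) (Finset.univ.filter fun x => col x = A)
      (Finset.univ.filter fun x => col x ≠ A) (colourMatching col R A B) := by
  have key : ∀ u u' v v', col u = A → col u' = A → col v = B → col v' = B → G.Adj u v' →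
      {u, v} ∈ R → {u', v'} ∈ R → u = u' ∧ v = v' := by
    intro u u' v v' hu hu' hv hv' h h1 h2
    have h3 := hR u u' v v' (hu.trans hu'.symm) (hv.trans hv'.symm) h h1 h2
    have m1 : u ∈ ({u', v'} : Finset V) := h3 ▸ by simp
    have m2 : v ∈ ({u', v'} : Finset V) := h3 ▸ by simp
    rw [Finset.mem_insert, Finset.mem_singleton] at m1 m2
    refine ⟨m1.resolve_right ?_, m2.resolve_left ?_⟩
    · rintro rfl; exact hAB (hu.symm.trans hv')
    · rintro rfl; exact hAB (hu'.symm.trans hv)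
  have hform : ∀ e ∈ colourMatching col R A B, ∃ a b, e = s(a, b) ∧ {a, b} ∈ R ∧ col a = A ∧
      col b = B := fun e he => by
    simpa [colourMatching] using he
  refine ⟨?_, ?_, ?_⟩
  · intro e he
    obtain ⟨a, b, rfl, h, ha, hb⟩ := hform e he
    exact ⟨hadj a b h, Or.inl ⟨ha, hb⟩⟩
  · intro e he f hf hef w hwe hwf
    obtain ⟨a, b, rfl, h, ha, hb⟩ := hform e he
    obtain ⟨a', b', rfl, h', ha', hb'⟩ := hform f hf
    refine hef ?_
    rw [Sym2.mem_iff] at hwe hwf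
    rcases hwe with rfl | rfl <;> rcases hwf with rfl | rfl
    · rw [(key w w b b' ha ha' hb hb' (hadj _ _ h') h h').2]
    · exact absurd (ha.symm.trans hb') hAB
    · exact absurd (ha'.symm.trans hb) hAB
    · rw [(key a a' w w ha ha' hb hb' (hadj _ _ h) h h').1]
  · intro u hu u' hu' v hv v' hv' he he' hne
    simp only [Finset.mem_filter, Finset.mem_univ, true_and] at hu hu' hv hv'
    rw [mk_mem_colourMatching] at he he'
    have hvB := (he.2.resolve_right fun h => hv h.2).2
    have hvB' := (he'.2.resolve_right fun h => hv' h.2).2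
    refine ⟨fun h => hne ?_, fun h => hne ?_⟩
    · obtain ⟨rfl, rfl⟩ := key u u' v v' hu hu' hvB hvB' h.1 he.1 he'.1
      rfl
    · obtain ⟨rfl, rfl⟩ := key u' u v' v hu' hu hvB' hvB h.1 he'.1 he.1
      rfl

theorem card_le_sum_card_colourMatching {R : Finset (Finset V)}
    (hcard : ∀ e ∈ R, e.card = 2) (hcol : ∀ x y, x ≠ y → col x = col y → {x, y} ∉ R) :
    R.card ≤ ∑ A, ∑ B, if A = B then 0 else (colourMatching col R A B).card := by
  have hsub : R ⊆ (Finset.univ.filter fun p : Fin m × Fin m => p.1 ≠ p.2).biUnion fun p =>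
      (colourMatching col R p.1 p.2).image Sym2.toFinset := by
    intro e he
    obtain ⟨x, y, hxy, rfl⟩ := Finset.card_eq_two.1 (hcard e he)
    refine Finset.mem_biUnion.2 ⟨(col x, col y), ?_, Finset.mem_image.2 ⟨s(x, y), ?_, ?_⟩⟩
    · simpa using fun h => hcol x y hxy h he
    · exact mk_mem_colourMatching.2 ⟨he, Or.inl ⟨rfl, rfl⟩⟩
    · exact Sym2.toFinset_mk_eq
  refine (Finset.card_le_card hsub).trans (Finset.card_biUnion_le.trans ?_)
  rw [Finset.sum_filter, ← Fintype.sum_prod_type']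
  refine Finset.sum_le_sum fun p _ => ?_
  by_cases h : p.1 = p.2
  · simp [h]
  · simpa [h] using Finset.card_image_le

/-- Suppose the vertices of a flag complex are coloured with `m` colours so that two vertices of
the same colour with a common neighbour are adjacent. Then the second Betti number is at most
`m ^ 3` times `I(n)`. -/
theorem finrank_reducedHomology_le (k : Type*) [Field k] {K : AbstractSimplicialComplex V}
    (hK : IsFlag K) {n : ℕ} (hn : Fintype.card V ≤ n)
    (hcol : ∀ u v w, u ≠ v → col u = col v → (edgeGraph K).Adj w u → (edgeGraph K).Adj w v →
      (edgeGraph K).Adj u v) :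
    Module.finrank k (ReducedHomology k K 2) ≤ m ^ 3 * maxInducedMatchings n := by
  obtain ⟨R, hnew, hle, hsame, hind⟩ := exists_newEdges_family k hcol
  have h1 := finrank_reducedHomology_add k K 2
  have h2 : cycles k K 2 = cliqueCycles k (edgeGraph K) Set.univ 3 := by
    unfold cycles cliqueCycles; rw [hK.chains_eq k]
  have h3 : boundaries k K 2 = cliqueBoundaries k (edgeGraph K) Set.univ 3 := by
    unfold boundaries cliqueBoundaries; rw [hK.chains_eq k]
  replace h2 := congrArg (fun S : Submodule k _ => Module.finrank k S) h2
  replace h3 := congrArg (fun S : Submodule k _ => Module.finrank k S) h3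
  have h4 : Module.finrank k (ReducedHomology k K 2) ≤ ∑ w, (R w).card := by omega
  have hadj : ∀ w x y, {x, y} ∈ R w → (edgeGraph K).Adj x y := by
    intro w x y h
    obtain ⟨-, hcl, hcard, -⟩ := hnew w h
    refine hcl (by simp) (by simp) ?_
    rintro rfl
    simp at hcard
  -- Edges of `R w'` lie among the lower neighbours of `w'`, so none of them is new at a later `w`
  -- of the same colour.
  have hdisj : ∀ w w', w' < w → col w' = col w → ∀ A B,
      Disjoint (colourMatching col (R w) A B) (colourMatching col (R w') A B) := by
    intro w w' hlt hc A B
    rw [Finset.disjoint_left]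
    intro e he he'
    induction e using Sym2.ind with
    | _ a b =>
      exact (hnew w (mk_mem_colourMatching.1 he).1).2.2.2 w' hlt hc
        (hnew w' (mk_mem_colourMatching.1 he').1).1
  have hABC : ∀ A B C : Fin m, A ≠ B →
      ∑ w : {w // col w = C}, (colourMatching col (R w) A B).card ≤ maxInducedMatchings n := by
    intro A B C hAB
    refine sum_card_le_maxInducedMatchings (colourGraph (edgeGraph K) col A B)
      (Finset.univ.filter fun x => col x = A) (Finset.univ.filter fun x => col x ≠ A)
      _ ((Fintype.card_subtype_le _).trans hn) ?_ ?_ ((Finset.card_le_univ _).trans hn)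
      ((Finset.card_le_univ _).trans hn)
      (fun w => isInducedMatching_colourMatching hAB (hadj w) (hind w)) ?_
    · refine ⟨?_, ?_⟩
      · rw [Finset.disjoint_coe]
        exact Finset.disjoint_filter_filter_not _ _ _
      · rintro x y ⟨-, ⟨hx, hy⟩ | ⟨hx, hy⟩⟩
        · left; simp [hx, hy, hAB.symm]
        · right; simp [hx, hy, hAB.symm]
    · ext x; simp [em]
    · rintro ⟨w, hw⟩ ⟨w', hw'⟩ hne
      have hne' : w ≠ w' := fun h => hne (Subtype.ext h)
      rcases lt_or_gt_of_ne hne' with h | h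
      · exact (hdisj w' w h (hw.trans hw'.symm) A B).symm
      · exact hdisj w w' h (hw'.trans hw.symm) A B
  calc Module.finrank k (ReducedHomology k K 2) ≤ ∑ w, (R w).card := h4
    _ ≤ ∑ w, ∑ A, ∑ B, if A = B then 0 else (colourMatching col (R w) A B).card :=
        Finset.sum_le_sum fun w _ => card_le_sum_card_colourMatching
          (fun e he => (hnew w he).2.2.1) (hsame w)
    _ = ∑ C, ∑ w : {w // col w = C}, ∑ A, ∑ B,
          if A = B then 0 else (colourMatching col (R w) A B).card :=
        (Fintype.sum_fiberwise col _).symm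
    _ = ∑ C, ∑ A, ∑ B, ∑ w : {w // col w = C},
          if A = B then 0 else (colourMatching col (R w) A B).card := by
        refine Finset.sum_congr rfl fun C _ => ?_
        rw [Finset.sum_comm]
        exact Finset.sum_congr rfl fun A _ => Finset.sum_comm
    _ ≤ ∑ C : Fin m, ∑ A : Fin m, ∑ B : Fin m, maxInducedMatchings n := by
        refine Finset.sum_le_sum fun C _ => Finset.sum_le_sum fun A _ =>
          Finset.sum_le_sum fun B _ => ?_
        by_cases h : A = B
        · simp [h]
        · simpa [h] using hABC A B C h
    _ = m ^ 3 * maxInducedMatchings n := by simp; ring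

/-- The points of `ℝ ^ d` can be coloured with finitely many colours so that points of the same
colour at distance at most `2` are at distance at most `α`. -/
theorem exists_colouring (d : ℕ) {α : ℝ} (hα : 0 < α) :
    ∃ (m : ℕ) (c : EuclideanSpace ℝ (Fin d) → Fin m), ∀ x y, c x = c y → dist x y ≤ 2 →
      dist x y ≤ α := by
  -- With grid side `s`, points in a common cell are at distance at most `d * s ≤ α`; the `+ 1`
  -- keeps the denominator positive when `d = 0`.
  set s : ℝ := α / (d + 1) with hs
  have hs0 : 0 < s := by positivity
  -- At distance at most `2` the rescaled coordinates differ by less than `q - 1`, hence their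
  -- floors by less than `q`, so equal residues force equal floors.
  obtain ⟨q, hq⟩ := exists_nat_gt (2 / s + 1)
  have hq0 : 0 < q := by
    have : (0 : ℝ) < q := lt_trans (by positivity) hq
    exact_mod_cast this
  have : NeZero q := ⟨hq0.ne'⟩
  let c : EuclideanSpace ℝ (Fin d) → Fin d → ZMod q := fun x i => ((⌊x i / s⌋ : ℤ) : ZMod q)
  refine ⟨Fintype.card (Fin d → ZMod q), fun x => Fintype.equivFin _ (c x), ?_⟩
  intro x y hxy h2
  have hc : c x = c y := (Fintype.equivFin _).injective hxy
  have hcoord : ∀ i, |x i - y i| ≤ s := by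
    intro i
    have hd2 : |x i - y i| ≤ 2 := by
      have h := PiLp.norm_apply_le (x - y) i
      rw [PiLp.sub_apply, Real.norm_eq_abs, ← dist_eq_norm] at h
      exact h.trans h2
    have hci : ((⌊x i / s⌋ : ℤ) : ZMod q) = ((⌊y i / s⌋ : ℤ) : ZMod q) := congrFun hc i
    rw [ZMod.intCast_eq_intCast_iff_dvd_sub] at hci
    have hdiv : |x i / s - y i / s| < q - 1 := by
      rw [← sub_div, abs_div, abs_of_pos hs0]
      calc |x i - y i| / s ≤ 2 / s := by gcongr
        _ < q - 1 := by linarith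
    have hfl : ⌊y i / s⌋ - ⌊x i / s⌋ = 0 := by
      refine Int.eq_zero_of_abs_lt_dvd hci ?_
      have b1 := Int.floor_le (x i / s)
      have b2 := Int.lt_floor_add_one (x i / s)
      have b3 := Int.floor_le (y i / s)
      have b4 := Int.lt_floor_add_one (y i / s)
      rw [abs_lt] at hdiv
      have : |((⌊y i / s⌋ - ⌊x i / s⌋ : ℤ) : ℝ)| < q := by
        push_cast
        rw [abs_lt]
        constructor <;> linarith [hdiv.1, hdiv.2]
      exact_mod_cast this
    have hlt := Int.abs_sub_lt_one_of_floor_eq_floor (sub_eq_zero.1 hfl).symm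
    rw [← sub_div, abs_div, abs_of_pos hs0, div_lt_one hs0] at hlt
    exact hlt.le
  have hsum : dist x y ≤ ∑ i : Fin d, s := by
    rw [EuclideanSpace.dist_eq]
    refine Real.sqrt_le_iff.2 ⟨by positivity, ?_⟩
    refine le_trans ?_ (Finset.sum_sq_le_sq_sum_of_nonneg fun i _ => hs0.le)
    refine Finset.sum_le_sum fun i _ => ?_
    rw [Real.dist_eq]
    have := hcoord i
    gcongr
  refine hsum.trans ?_
  rw [Finset.sum_const, Finset.card_univ, Fintype.card_fin, nsmul_eq_mul, hs, ← mul_div_assoc,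
    div_le_iff₀ (by positivity)]
  nlinarith

/-- The second Betti numbers of quasi-Rips complexes are bounded by a multiple of `I(n)`. -/
theorem exists_maxQuasiRipsBetti_le (d : ℕ) {α : ℝ} (hα : 0 < α) :
    ∃ D : ℕ, ∀ (n : ℕ) (k : Type*) [Field k],
      maxQuasiRipsBetti k α 2 d n ≤ D * maxInducedMatchings n := by
  obtain ⟨m, c, hc⟩ := exists_colouring d hα
  refine ⟨m ^ 3, fun n k _ => ?_⟩
  obtain ⟨S, K, hS, hK, hb⟩ := (isGreatest_maxQuasiRipsBetti k α 2 d n).1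
  rw [← hb]
  unfold reducedBetti
  let _ : LinearOrder S := open Classical in linearOrderOfSTO WellOrderingRel
  refine finrank_reducedHomology_le k (col := fun x : S => c x) hK.isFlag (by simpa using hS) ?_
  intro u v w huv hcuv hwu hwv
  have hle : ∀ x, (edgeGraph K).Adj w x →
      dist (w : EuclideanSpace ℝ (Fin d)) x ≤ 1 := by
    intro x hx
    by_contra! h
    exact hK.not_edge_of_lt_dist w x hx.1 h (by convert hx.2)
  have h2 : dist (u : EuclideanSpace ℝ (Fin d)) v ≤ 2 := by
    have := dist_triangle_left (u : EuclideanSpace ℝ (Fin d)) v w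
    linarith [hle u hwu, hle v hwv]
  exact ⟨huv, by convert hK.edge_of_dist_le u v huv (hc _ _ hcuv h2)⟩

end UpperBound

/-! ### Octahedral cycles detected on facets. -/

section Octahedra

variable (k : Type*) [Field k] {V : Type*} [LinearOrder V]

/-- The oriented simplex on a list of three vertices, zero if they are not distinct. -/
def orientedTriangle (p q r : V) : Finset V →₀ k :=
  cone k p (cone k q (cone k r (Finsupp.single ∅ 1)))

/-- Only whether the coefficient vanishes matters later, so the sign is left unspecified. -/
theorem exists_orientedTriangle_eq (p q r : V) :
    ∃ c : k, orientedTriangle k p q r = c • Finsupp.single {p, q, r} 1 ∧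
      (c ≠ 0 ↔ p ≠ q ∧ p ≠ r ∧ q ≠ r) := by
  unfold orientedTriangle
  rw [cone_single, if_neg (Finset.notMem_empty r), map_smul, cone_single]
  by_cases hqr : q = r
  · exact ⟨0, by simp [hqr], by simp [hqr]⟩
  rw [if_neg (by simpa using hqr), map_smul, map_smul, cone_single]
  by_cases hp : p ∈ ({q, r} : Finset V)
  · rw [Finset.mem_insert, Finset.mem_singleton] at hp
    refine ⟨0, ?_, by tauto⟩
    rw [if_pos (by simpa using hp), smul_zero, smul_zero, zero_smul]
  · refine ⟨orientationSign k r ∅ * (orientationSign k q {r} * orientationSign k p {q, r}), ?_, ?_⟩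
    · rw [mul_smul, mul_smul]
      exact congrArg _ (congrArg _ (if_neg hp))
    · rw [Finset.mem_insert, Finset.mem_singleton, not_or] at hp
      simp [hqr, hp, orientationSign_ne_zero]

theorem orientedTriangle_apply_eq_zero {p q r : V} {s : Finset V} (h : {p, q, r} ≠ s) :
    orientedTriangle k p q r s = 0 := by
  obtain ⟨c, hc, -⟩ := exists_orientedTriangle_eq k p q r
  rw [hc, Finsupp.smul_apply, Finsupp.single_eq_of_ne' h, smul_zero]

/-- The boundary of the octahedron with antipodal pairs `w, x`, `u, u'` and `v, v'`. -/
def octahedronCycle (w x u u' v v' : V) : Finset V →₀ k :=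
  (cone k w - cone k x) ((cone k u - cone k u') ((cone k v - cone k v') (Finsupp.single ∅ 1)))

/-- This is the suspension of a cycle with poles `w` and `x`: the two copies of `y` in the boundary
cancel. -/
theorem boundary_cone_sub_cone (w x : V) {y : Finset V →₀ k} (hy : boundary k y = 0) :
    boundary k ((cone k w - cone k x) y) = 0 := by
  rw [LinearMap.sub_apply, map_sub, boundary_cone, boundary_cone, hy, map_zero, map_zero, sub_self]

theorem boundary_octahedronCycle (w x u u' v v' : V) :
    boundary k (octahedronCycle k w x u u' v v') = 0 :=
  boundary_cone_sub_cone k _ _ <| boundary_cone_sub_cone k _ _ <| boundary_cone_sub_cone k _ _ <| by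
    rw [boundary_single_one, Finset.sum_empty]

theorem octahedronCycle_eq (w x u u' v v' : V) : octahedronCycle k w x u u' v v' =
    orientedTriangle k w u v - orientedTriangle k w u v'
      - (orientedTriangle k w u' v - orientedTriangle k w u' v')
      - (orientedTriangle k x u v - orientedTriangle k x u v'
        - (orientedTriangle k x u' v - orientedTriangle k x u' v')) := by
  simp only [octahedronCycle, orientedTriangle, LinearMap.sub_apply, map_sub]
  abel

/-- Each of the other seven triangles contains `x`, `u'` or `v'`. -/
theorem octahedronCycle_apply {w x u u' v v' : V} {s : Finset V} (hx : x ∉ s) (hu' : u' ∉ s)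
    (hv' : v' ∉ s) : octahedronCycle k w x u u' v v' s = orientedTriangle k w u v s := by
  have hne : ∀ {p q r y : V}, y ∈ ({p, q, r} : Finset V) → y ∉ s → ({p, q, r} : Finset V) ≠ s :=
    fun h1 h2 h => h2 (h ▸ h1)
  rw [octahedronCycle_eq]
  simp only [Finsupp.sub_apply]
  rw [orientedTriangle_apply_eq_zero k (p := w) (q := u) (r := v') (hne (by simp) hv'),
    orientedTriangle_apply_eq_zero k (p := w) (q := u') (r := v) (hne (by simp) hu'),
    orientedTriangle_apply_eq_zero k (p := w) (q := u') (r := v') (hne (by simp) hu'),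
    orientedTriangle_apply_eq_zero k (p := x) (q := u) (r := v) (hne (by simp) hx),
    orientedTriangle_apply_eq_zero k (p := x) (q := u) (r := v') (hne (by simp) hx),
    orientedTriangle_apply_eq_zero k (p := x) (q := u') (r := v) (hne (by simp) hx),
    orientedTriangle_apply_eq_zero k (p := x) (q := u') (r := v') (hne (by simp) hx)]
  simp

theorem orientedTriangle_mem_chains {K : AbstractSimplicialComplex V} {p q r : V}
    (h : {p, q, r} ∈ K) : orientedTriangle k p q r ∈ chains k K 3 := by
  obtain ⟨c, hc, hc0⟩ := exists_orientedTriangle_eq k p q r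
  rw [hc]
  by_cases h0 : c = 0
  · rw [h0, zero_smul]; exact Submodule.zero_mem _
  · obtain ⟨h1, h2, h3⟩ := hc0.1 h0
    exact Submodule.smul_mem _ _ (Finsupp.single_mem_supported k _
      ⟨Or.inr h, Finset.card_eq_three.2 ⟨p, q, r, h1, h2, h3, rfl⟩⟩)

/-- A family of octahedra in a complex, each with a triangle that is a facet of the complex and
lies in no other octahedron of the family, bounds the second Betti number from below. -/
theorem card_le_finrank_reducedHomology [Fintype V] (K : AbstractSimplicialComplex V) {ι : Type*}
    [Fintype ι] (w x u u' v v' : ι → V)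
    (hface : ∀ i, ∀ p ∈ ({w i, x i} : Set V), ∀ q ∈ ({u i, u' i} : Set V),
      ∀ r ∈ ({v i, v' i} : Set V), {p, q, r} ∈ K)
    (hne : ∀ i, w i ≠ u i ∧ w i ≠ v i ∧ u i ≠ v i)
    (hfacet : ∀ i, ∀ t ∈ K, {w i, u i, v i} ⊆ t → t.card ≤ 3)
    (hinj : ∀ i j, ({w i, u i, v i} : Finset V) = {w j, u j, v j} → i = j)
    (hx : ∀ i j, x i ∉ ({w j, u j, v j} : Finset V))
    (hu' : ∀ i j, u' i ∉ ({w j, u j, v j} : Finset V))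
    (hv' : ∀ i j, v' i ∉ ({w j, u j, v j} : Finset V)) :
    Fintype.card ι ≤ Module.finrank k (ReducedHomology k K 2) := by
  classical
  -- `Ψ` reads the coefficients at the distinguished triangles. It maps the cycles onto `ι → k`,
  -- each octahedron going to a nonzero multiple of a unit vector, and it kills boundaries because a
  -- facet is not a face of any tetrahedron.
  let Ψ : (Finset V →₀ k) →ₗ[k] (ι → k) :=
    LinearMap.pi fun i => Finsupp.lapply ({w i, u i, v i} : Finset V)
  let z : ι → Finset V →₀ k := fun i => octahedronCycle k (w i) (x i) (u i) (u' i) (v i) (v' i)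
  have hz : ∀ i, z i ∈ cycles k K 2 := by
    intro i
    refine Submodule.mem_inf.2 ⟨?_, boundary_octahedronCycle k _ _ _ _ _ _⟩
    have hm : ∀ p ∈ ({w i, x i} : Set V), ∀ q ∈ ({u i, u' i} : Set V),
        ∀ r ∈ ({v i, v' i} : Set V), orientedTriangle k p q r ∈ chains k K 3 :=
      fun p hp q hq r hr => orientedTriangle_mem_chains k (hface i p hp q hq r hr)
    simp only [Set.mem_insert_iff, Set.mem_singleton_iff, forall_eq_or_imp, forall_eq] at hm
    obtain ⟨⟨⟨h1, h2⟩, h3, h4⟩, ⟨h5, h6⟩, h7, h8⟩ := hm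
    change octahedronCycle k (w i) (x i) (u i) (u' i) (v i) (v' i) ∈ chains k K 3
    rw [octahedronCycle_eq]
    exact Submodule.sub_mem _ (Submodule.sub_mem _ (Submodule.sub_mem _ h1 h2)
      (Submodule.sub_mem _ h3 h4)) (Submodule.sub_mem _ (Submodule.sub_mem _ h5 h6)
      (Submodule.sub_mem _ h7 h8))
  have hΨz : ∀ i, ∃ c : k, c ≠ 0 ∧ Ψ (z i) = c • Pi.single i 1 := by
    intro i
    obtain ⟨c, hc, hc0⟩ := exists_orientedTriangle_eq k (w i) (u i) (v i)
    refine ⟨c, hc0.2 (hne i), ?_⟩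
    ext j
    change octahedronCycle k (w i) (x i) (u i) (u' i) (v i) (v' i) {w j, u j, v j} = _
    rw [octahedronCycle_apply k (hx i j) (hu' i j) (hv' i j)]
    rcases eq_or_ne i j with rfl | hij
    · rw [hc]; simp
    · rw [orientedTriangle_apply_eq_zero k fun h => hij (hinj i j h)]
      simp [Pi.single_eq_of_ne hij.symm]
  have htop : (cycles k K 2).map Ψ = ⊤ := by
    rw [eq_top_iff, ← (Pi.basisFun k ι).span_eq, Submodule.span_le]
    rintro _ ⟨i, rfl⟩
    obtain ⟨c, hc, h⟩ := hΨz i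
    rw [Pi.basisFun_apply, SetLike.mem_coe, ← Submodule.smul_mem_iff _ hc, ← h]
    exact Submodule.mem_map_of_mem (hz i)
  have hker : boundaries k K 2 ≤ cycles k K 2 ⊓ LinearMap.ker Ψ := by
    refine le_inf (boundaries_le_cycles k K 2) ?_
    rw [boundaries, Submodule.map_le_iff_le_comap, chains, Finsupp.supported_eq_span_single,
      Submodule.span_le]
    rintro _ ⟨s, ⟨hs, hc⟩, rfl⟩
    rw [SetLike.mem_coe, Submodule.mem_comap, LinearMap.mem_ker]
    ext i
    change boundary k (Finsupp.single s 1) {w i, u i, v i} = 0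
    rw [boundary_single_one, Finsupp.finsetSum_apply]
    refine Finset.sum_eq_zero fun y hy => ?_
    rw [Finsupp.smul_apply, Finsupp.single_eq_of_ne', smul_zero]
    intro h
    have hsK : s ∈ K := hs.resolve_left (by rintro rfl; simp at hc)
    have := hfacet i s hsK (h ▸ Finset.erase_subset y s)
    omega
  have h1 := finrank_reducedHomology_add k K 2
  have h2 := finrank_map_add_finrank_inf_ker (cycles k K 2) Ψ
  have h3 := Submodule.finrank_mono hker
  rw [htop, finrank_top, Module.finrank_fintype_fun_eq_card] at h2
  omega

end Octahedra

/-! ### Four clusters in the plane. -/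

section Geometry

/-- The point with coordinates `p`, `q` in a coordinate plane of `ℝ ^ d`. -/
def planePoint {d : ℕ} (hd : 2 ≤ d) (p q : ℝ) : EuclideanSpace ℝ (Fin d) :=
  EuclideanSpace.single ⟨0, by omega⟩ p + EuclideanSpace.single ⟨1, by omega⟩ q

theorem dist_planePoint {d : ℕ} (hd : 2 ≤ d) (p q p' q' : ℝ) :
    dist (planePoint hd p q) (planePoint hd p' q') = √((p - p') ^ 2 + (q - q') ^ 2) := by
  have h : planePoint hd p q - planePoint hd p' q' = EuclideanSpace.single ⟨0, by omega⟩ (p - p') +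
      EuclideanSpace.single ⟨1, by omega⟩ (q - q') := by
    ext i
    simp only [planePoint, PiLp.sub_apply, PiLp.add_apply, PiLp.single_apply]
    split_ifs <;> ring
  rw [dist_eq_norm, h, eq_comm, Real.sqrt_eq_iff_mul_self_eq (by positivity) (norm_nonneg _),
    ← sq, norm_add_sq_real]
  simp [EuclideanSpace.inner_single_left]

/-- The first coordinates of the vertices of a rhombus of side `r` with an angle of `60` degrees. -/
def rhombusFst (r : ℝ) : Fin 4 → ℝ := ![0, r, r / 2, r / 2]

/-- The second coordinates of the vertices of the rhombus. -/
def rhombusSnd (r : ℝ) : Fin 4 → ℝ := ![0, 0, r * √3 / 2, -(r * √3 / 2)]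

theorem dist_rhombus {d : ℕ} (hd : 2 ≤ d) {r : ℝ} (hr : 0 ≤ r) (i j : Fin 4) :
    dist (planePoint hd (rhombusFst r i) (rhombusSnd r i))
      (planePoint hd (rhombusFst r j) (rhombusSnd r j)) =
        if i = j then 0 else if i = 2 ∧ j = 3 ∨ i = 3 ∧ j = 2 then r * √3 else r := by
  have h3 : √3 ^ 2 = (3 : ℝ) := Real.sq_sqrt (by norm_num)
  rw [dist_planePoint]
  have key : ∀ {a b : ℝ}, 0 ≤ b → a = b ^ 2 → √a = b := fun hb h => by
    rw [h, Real.sqrt_sq hb]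
  fin_cases i <;> fin_cases j <;> simp [rhombusFst, rhombusSnd] <;>
    refine key (by positivity) ?_ <;> ring_nf <;> rw [h3] <;> ring

/-- A finite set can be placed in `ℝ ^ d` in four tight clusters, near the vertices of a rhombus,
so that only the last two clusters are at distance greater than `1`. -/
theorem exists_clustered_points {d : ℕ} (hd : 2 ≤ d) {α : ℝ} (hα₀ : 0 < α) (hα₁ : α < 1)
    {X : Type*} [Fintype X] (cl : X → Fin 4) :
    ∃ P : X → EuclideanSpace ℝ (Fin d), Function.Injective P ∧
      (∀ a b, cl a ≠ cl b → α < dist (P a) (P b)) ∧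
      ∀ a b, ¬ (cl a = 2 ∧ cl b = 3 ∨ cl a = 3 ∧ cl b = 2) → dist (P a) (P b) ≤ 1 := by
  -- All distances stay within `ε` of those of the rhombus, and `ε ≤ (1 - α) / 20` gives `α < r - ε`
  -- and `r + ε ≤ 1`.
  set ε : ℝ := α * (1 - α) / 20 with hε
  set r : ℝ := (9 + α) / 10 with hr
  have hε0 : 0 < ε := by have := sub_pos.2 hα₁; positivity
  have hε1 : ε ≤ (1 - α) / 20 := by rw [hε]; nlinarith
  have h3 : 1.7 ≤ √3 := Real.le_sqrt_of_sq_le (by norm_num)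
  let δ : X → ℝ := fun a => ε * ((Fintype.equivFin X a : ℕ) / (Fintype.card X : ℝ))
  have hδ : ∀ a, 0 ≤ δ a ∧ δ a ≤ ε := by
    intro a
    have hlt : ((Fintype.equivFin X a : ℕ) : ℝ) ≤ Fintype.card X := by
      exact_mod_cast (Fintype.equivFin X a).2.le
    refine ⟨by positivity, ?_⟩
    exact mul_le_of_le_one_right hε0.le (div_le_one_of_le₀ hlt (by positivity))
  have hδinj : Function.Injective δ := by
    intro a b h
    have hX : (Fintype.card X : ℝ) ≠ 0 := by
      have : Nonempty X := ⟨a⟩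
      exact_mod_cast Fintype.card_ne_zero
    have h1 := mul_left_cancel₀ hε0.ne' h
    rw [div_left_inj' hX] at h1
    exact (Fintype.equivFin X).injective (Fin.ext (by exact_mod_cast h1))
  let Q : X → EuclideanSpace ℝ (Fin d) := fun a =>
    planePoint hd (rhombusFst r (cl a)) (rhombusSnd r (cl a))
  let P : X → EuclideanSpace ℝ (Fin d) := fun a =>
    planePoint hd (rhombusFst r (cl a) + δ a) (rhombusSnd r (cl a))
  have hcomp : ∀ a b, |dist (P a) (P b) - dist (Q a) (Q b)| ≤ ε := by
    intro a b
    -- Translating both points by `-δ a` moves the whole relative displacement onto the second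
    -- point.
    let Q' : EuclideanSpace ℝ (Fin d) :=
      planePoint hd (rhombusFst r (cl b) + (δ b - δ a)) (rhombusSnd r (cl b))
    have e1 : dist (P a) (P b) = dist (Q a) Q' := by
      rw [dist_planePoint, dist_planePoint]; congr 1; ring
    have e2 : dist Q' (Q b) ≤ ε := by
      rw [dist_planePoint, Real.sqrt_le_left hε0.le]
      nlinarith [hδ a, hδ b]
    rw [e1, dist_comm, dist_comm (Q a)]
    exact (abs_dist_sub_le _ _ _).trans e2
  have hfar : ∀ a b, cl a ≠ cl b → α < dist (P a) (P b) := by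
    intro a b hab
    have h1 := (abs_le.1 (hcomp a b)).1
    have h2 := dist_rhombus hd (r := r) (by positivity) (cl a) (cl b)
    rw [if_neg hab] at h2
    change dist (Q a) (Q b) = _ at h2
    rw [h2] at h1
    split_ifs at h1 <;> nlinarith
  refine ⟨P, ?_, hfar, ?_⟩
  · intro a b hab
    by_contra hne
    by_cases hc : cl a = cl b
    · have h0 : dist (P a) (P b) = 0 := by rw [hab, dist_self]
      rw [dist_planePoint, hc, sub_self, zero_pow two_ne_zero, add_zero, add_sub_add_left_eq_sub,
        Real.sqrt_sq_eq_abs, abs_eq_zero, sub_eq_zero] at h0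
      exact hne (hδinj h0)
    · have := hfar a b hc
      rw [hab, dist_self] at this
      linarith
  · intro a b hab
    have h1 := (abs_le.1 (hcomp a b)).2
    have h2 := dist_rhombus hd (r := r) (by positivity) (cl a) (cl b)
    rw [if_neg hab] at h2
    change dist (Q a) (Q b) = _ at h2
    rw [h2] at h1
    split_ifs at h1 <;> linarith

end Geometry

/-! ### The lower bound: a complex realizing a family of induced matchings. -/

section LowerBound

/-- The simplicial complex of nonempty cliques of a graph. -/
def cliqueComplex {V : Type*} (H : SimpleGraph V) : AbstractSimplicialComplex V where
  faces := {s | s.Nonempty ∧ H.IsClique (s : Set V)}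
  isRelLowerSet_faces := fun _ hs => ⟨hs.1, fun _ hts ht => ⟨ht, hs.2.subset hts⟩⟩
  singleton_mem := fun v => ⟨Finset.singleton_nonempty v, by simp⟩

theorem mem_cliqueComplex {V : Type*} {H : SimpleGraph V} {s : Finset V} :
    s ∈ cliqueComplex H ↔ s.Nonempty ∧ H.IsClique (s : Set V) := Iff.rfl

theorem pair_mem_cliqueComplex {V : Type*} [DecidableEq V] {H : SimpleGraph V} {u v : V}
    (huv : u ≠ v) : {u, v} ∈ cliqueComplex H ↔ H.Adj u v := by
  simp [mem_cliqueComplex, SimpleGraph.isClique_insert, huv]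

theorem isFlag_cliqueComplex {V : Type*} (H : SimpleGraph V) : IsFlag (cliqueComplex H) := by
  classical
  refine fun s hs h => ⟨hs, fun u hu v hv huv => ?_⟩
  exact (pair_mem_cliqueComplex huv).1 (by convert h u hu v hv huv)

/-- Octahedra in a graph, each with a triangle that has no common neighbour and lies in no other
octahedron, give a lower bound for the second Betti number of the clique complex. -/
theorem card_le_reducedBetti_cliqueComplex (k : Type*) [Field k] {Y : Type*} [Finite Y]
    (H : SimpleGraph Y) {ι : Type*} [Fintype ι] (w x u u' v v' : ι → Y)
    (hadj : ∀ i, ∀ p ∈ ({w i, x i} : Set Y), ∀ q ∈ ({u i, u' i} : Set Y),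
      ∀ r ∈ ({v i, v' i} : Set Y), H.Adj p q ∧ H.Adj p r ∧ H.Adj q r)
    (hfacet : ∀ i y, H.Adj (w i) y → H.Adj (u i) y → ¬ H.Adj (v i) y)
    (hinj : ∀ i j, ({w i, u i, v i} : Set Y) = {w j, u j, v j} → i = j)
    (hx : ∀ i j, x i ∉ ({w j, u j, v j} : Set Y))
    (hu' : ∀ i j, u' i ∉ ({w j, u j, v j} : Set Y))
    (hv' : ∀ i j, v' i ∉ ({w j, u j, v j} : Set Y)) :
    Fintype.card ι ≤ reducedBetti k (cliqueComplex H) 2 := by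
  have := Fintype.ofFinite Y
  unfold reducedBetti
  let _ : LinearOrder Y := open Classical in linearOrderOfSTO WellOrderingRel
  refine card_le_finrank_reducedHomology k _ w x u u' v v' ?_ ?_ ?_ ?_ ?_ ?_ ?_
  · intro i p hp q hq r hr
    obtain ⟨h1, h2, h3⟩ := hadj i p hp q hq r hr
    refine mem_cliqueComplex.2 ⟨by simp, ?_⟩
    simp [SimpleGraph.isClique_insert, h1, h2, h3]
  · intro i
    obtain ⟨h1, h2, h3⟩ := hadj i (w i) (by simp) (u i) (by simp) (v i) (by simp)
    exact ⟨h1.ne, h2.ne, h3.ne⟩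
  · intro i t ht hsub
    refine (Finset.card_le_card ?_).trans (Finset.card_le_three (a := w i) (b := u i) (c := v i))
    intro y hy
    by_contra hcon
    simp only [Finset.mem_insert, Finset.mem_singleton, not_or] at hcon
    have hcl := (mem_cliqueComplex.1 ht).2
    exact hfacet i y (hcl (hsub (by simp)) hy (Ne.symm hcon.1))
      (hcl (hsub (by simp)) hy (Ne.symm hcon.2.1)) (hcl (hsub (by simp)) hy (Ne.symm hcon.2.2))
  · intro i j hij
    have h := congrArg (fun s : Finset Y => (s : Set Y)) hij
    simp only [Finset.coe_insert, Finset.coe_singleton] at h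
    exact hinj i j h
  · exact fun i j h => hx i j (by simpa using h)
  · exact fun i j h => hu' i j (by simpa using h)
  · exact fun i j h => hv' i j (by simpa using h)

/-- A graph whose vertices fall into four cliques, two of them not joined by edges, has a clique
complex that is isomorphic to a quasi-Rips complex. -/
theorem exists_isQuasiRips_map {d : ℕ} (hd : 2 ≤ d) {α : ℝ} (hα₀ : 0 < α) (hα₁ : α < 1)
    {X : Type*} [Fintype X] (H : SimpleGraph X) (cl : X → Fin 4)
    (hcl : ∀ a b, a ≠ b → cl a = cl b → H.Adj a b)
    (hfar : ∀ a b, cl a = 2 → cl b = 3 → ¬ H.Adj a b) :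
    ∃ (S : Finset (EuclideanSpace ℝ (Fin d))) (e : X ≃ S),
      IsQuasiRips α S (cliqueComplex (H.map e)) := by
  classical
  obtain ⟨P, hP, hfarP, hnear⟩ := exists_clustered_points hd hα₀ hα₁ cl
  let S : Finset (EuclideanSpace ℝ (Fin d)) := Finset.univ.image P
  let e₀ : X → S := fun a => ⟨P a, Finset.mem_image_of_mem P (Finset.mem_univ a)⟩
  have he₀ : Function.Bijective e₀ := by
    refine ⟨fun a b h => hP (congrArg Subtype.val h), ?_⟩
    rintro ⟨y, hy⟩
    obtain ⟨a, -, rfl⟩ := Finset.mem_image.1 hy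
    exact ⟨a, rfl⟩
  let e : X ≃ S := Equiv.ofBijective e₀ he₀
  have hadj : ∀ a b, (H.map e).Adj (e a) (e b) ↔ H.Adj a b := fun a b =>
    SimpleGraph.map_adj_apply (f := e.toEmbedding)
  -- Points within `α` lie in one cluster, where all edges are present; points further than `1`
  -- apart lie in clusters `2` and `3`, where none is.
  refine ⟨S, e, isFlag_cliqueComplex _, fun y y' hne hdist => ?_, fun y y' hne hdist hmem => ?_⟩
  · obtain ⟨a, rfl⟩ := e.surjective y
    obtain ⟨b, rfl⟩ := e.surjective y'
    have hab : a ≠ b := fun h => hne (congrArg e h)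
    refine (pair_mem_cliqueComplex hne).2 ((hadj a b).2 (hcl a b hab ?_))
    by_contra h
    exact absurd (hfarP a b h) (not_lt.2 hdist)
  · obtain ⟨a, rfl⟩ := e.surjective y
    obtain ⟨b, rfl⟩ := e.surjective y'
    have hab := (hadj a b).1 ((pair_mem_cliqueComplex hne).1 hmem)
    refine absurd (hnear a b ?_) (not_le.2 hdist)
    rintro (⟨h1, h2⟩ | ⟨h1, h2⟩)
    · exact hfar a b h1 h2 hab
    · exact hfar b a h2 h1 hab.symm

/-- Octahedra in a graph whose vertices fall into four cliques, two of them not joined by edges,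
give a lower bound for the second Betti numbers of quasi-Rips complexes. -/
theorem card_le_maxQuasiRipsBetti (k : Type*) [Field k] {d : ℕ} (hd : 2 ≤ d) {α : ℝ} (hα₀ : 0 < α)
    (hα₁ : α < 1) {n : ℕ} {X : Type*} [Fintype X] (hn : Fintype.card X ≤ n) (H : SimpleGraph X)
    (cl : X → Fin 4) (hcl : ∀ a b, a ≠ b → cl a = cl b → H.Adj a b)
    (hfar : ∀ a b, cl a = 2 → cl b = 3 → ¬ H.Adj a b)
    {ι : Type*} [Fintype ι] (w x u u' v v' : ι → X)
    (hwx : ∀ i, ∀ p ∈ ({w i, x i} : Set X), ∀ q ∈ ({u i, u' i} : Set X),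
      ∀ r ∈ ({v i, v' i} : Set X), H.Adj p q ∧ H.Adj p r ∧ H.Adj q r)
    (hfacet : ∀ i y, H.Adj (w i) y → H.Adj (u i) y → ¬ H.Adj (v i) y)
    (hinj : ∀ i j, ({w i, u i, v i} : Set X) = {w j, u j, v j} → i = j)
    (hx : ∀ i j, x i ∉ ({w j, u j, v j} : Set X))
    (hu' : ∀ i j, u' i ∉ ({w j, u j, v j} : Set X))
    (hv' : ∀ i j, v' i ∉ ({w j, u j, v j} : Set X)) :
    Fintype.card ι ≤ maxQuasiRipsBetti k α 2 d n := by
  obtain ⟨S, e, hS⟩ := exists_isQuasiRips_map hd hα₀ hα₁ H cl hcl hfar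
  have hcard : S.card ≤ n := by
    rwa [← Fintype.card_coe, ← Fintype.card_congr e]
  refine le_trans ?_ ((isGreatest_maxQuasiRipsBetti k α 2 d n).2 ⟨S, _, hcard, hS, rfl⟩)
  have hadj : ∀ a b, (H.map e).Adj (e a) (e b) ↔ H.Adj a b := fun a b =>
    SimpleGraph.map_adj_apply (f := e.toEmbedding)
  have himage : ∀ a b c, ({e a, e b, e c} : Set S) = e '' {a, b, c} := fun a b c => by
    simp [Set.image_insert_eq]
  refine card_le_reducedBetti_cliqueComplex k _ (fun i => e (w i)) (fun i => e (x i))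
    (fun i => e (u i)) (fun i => e (u' i)) (fun i => e (v i)) (fun i => e (v' i)) ?_ ?_ ?_ ?_ ?_ ?_
  · intro i
    simpa only [Set.mem_insert_iff, Set.mem_singleton_iff, forall_eq_or_imp, forall_eq, hadj]
      using hwx i
  · intro i y
    obtain ⟨a, rfl⟩ := e.surjective y
    simpa only [hadj] using hfacet i a
  · intro i j hij
    rw [himage, himage] at hij
    exact hinj i j (e.injective.image_injective hij)
  all_goals
    intro i j
    rw [himage, e.injective.mem_set_image]
  · exact hx i j
  · exact hu' i j
  · exact hv' i j

/-- The relation, between vertices in cluster order, of the graph that realizes a family of induced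
matchings: besides the vertices of the bipartite graph it has one more vertex on each side, an apex
for each matching, and a pole. -/
def suspensionRel {W ι : Type*} (G : SimpleGraph W) (M : ι → Finset (Sym2 W)) {A B : Finset W}
    {T : Finset ι} : Option A ⊕ Option B ⊕ T ⊕ Unit → Option A ⊕ Option B ⊕ T ⊕ Unit → Prop
  | .inl _, .inl _ => True
  | .inl (some a), .inr (.inl (some b)) => G.Adj a b
  | .inl none, .inr (.inl none) => True
  | .inl (some a), .inr (.inr (.inl i)) => ∃ e ∈ M i, (a : W) ∈ e
  | .inl none, .inr (.inr (.inl _)) => True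
  | .inl _, .inr (.inr (.inr _)) => True
  | .inr (.inl _), .inr (.inl _) => True
  | .inr (.inl (some b)), .inr (.inr (.inl i)) => ∃ e ∈ M i, (b : W) ∈ e
  | .inr (.inl none), .inr (.inr (.inl _)) => True
  | .inr (.inl _), .inr (.inr (.inr _)) => True
  | .inr (.inr (.inl _)), .inr (.inr (.inl _)) => True
  | _, _ => False

/-- The four clusters of vertices. -/
def suspensionCluster {α β γ δ : Type*} : α ⊕ β ⊕ γ ⊕ δ → Fin 4
  | .inl _ => 0
  | .inr (.inl _) => 1
  | .inr (.inr (.inl _)) => 2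
  | .inr (.inr (.inr _)) => 3

theorem suspensionRel_of_cluster_eq {W ι : Type*} (G : SimpleGraph W) (M : ι → Finset (Sym2 W))
    {A B : Finset W} {T : Finset ι} (x y : Option A ⊕ Option B ⊕ T ⊕ Unit) (hxy : x ≠ y)
    (h : suspensionCluster x = suspensionCluster y) : suspensionRel G M x y := by
  rcases x with (_ | a) | (_ | b) | i | _ <;> rcases y with (_ | a') | (_ | b') | i' | _ <;>
    first
    | trivial
    | exact absurd rfl hxy
    | exact absurd h (by simp [suspensionCluster])

theorem not_suspensionRel {W ι : Type*} (G : SimpleGraph W) (M : ι → Finset (Sym2 W))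
    {A B : Finset W} {T : Finset ι} (x y : Option A ⊕ Option B ⊕ T ⊕ Unit)
    (hx : suspensionCluster x = 2) (hy : suspensionCluster y = 3) :
    ¬ suspensionRel G M x y ∧ ¬ suspensionRel G M y x := by
  rcases x with a | b | i | _
  · exact absurd hx (by simp [suspensionCluster])
  · exact absurd hx (by simp [suspensionCluster])
  · rcases y with a' | b' | i' | _
    · exact absurd hy (by simp [suspensionCluster])
    · exact absurd hy (by simp [suspensionCluster])
    · exact absurd hy (by simp [suspensionCluster])
    · exact ⟨id, id⟩
  · exact absurd hx (by simp [suspensionCluster])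

open Classical in
/-- The second Betti number of the complex that realizes a family of induced matchings. -/
theorem card_filter_le_maxQuasiRipsBetti (k : Type*) [Field k] {d : ℕ} (hd : 2 ≤ d) {α : ℝ}
    (hα₀ : 0 < α) (hα₁ : α < 1) {n n' : ℕ} (hn : 3 * n' + 3 ≤ n) {W ι : Type*}
    {G : SimpleGraph W} {U U' : Finset W} (hG : G.IsBipartiteWith (U : Set W) (U' : Set W))
    {M : ι → Finset (Sym2 W)} (hM : ∀ i, IsInducedMatching G U U' (M i))
    (hdisj : ∀ i j, i ≠ j → Disjoint (M i) (M j)) {A B : Finset W} {T : Finset ι} (hA : A ⊆ U)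
    (hB : B ⊆ U') (hAn : A.card ≤ n') (hBn : B.card ≤ n') (hTn : T.card ≤ n') :
    ((T ×ˢ A ×ˢ B).filter fun p => s(p.2.1, p.2.2) ∈ M p.1).card ≤
      maxQuasiRipsBetti k α 2 d n := by
  have hUU' : ∀ {x}, x ∈ U → x ∉ U' := fun {x} h h' =>
    Set.disjoint_left.1 hG.disjoint h h'
  have huniq : ∀ {i a b a' b'}, a ∈ U → b ∈ U' → a' ∈ U → b' ∈ U' → s(a, b) ∈ M i →
      s(a', b') ∈ M i → G.Adj a b' → a = a' ∧ b = b' := by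
    intro i a b a' b' ha hb ha' hb' h h' hadj
    by_contra hne
    refine ((hM i).induced a ha a' ha' b hb b' hb' h h' fun heq => hne ?_).1 hadj
    rcases Sym2.eq_iff.1 heq with h1 | ⟨rfl, rfl⟩
    · exact h1
    · exact absurd hb' (hUU' ha)
  have hother : ∀ {i a}, a ∈ U → (∃ e ∈ M i, a ∈ e) → ∃ b ∈ U', s(a, b) ∈ M i := by
    rintro i a ha ⟨e, he, hae⟩
    obtain ⟨b, rfl⟩ := Sym2.mem_iff_exists.1 hae
    rcases hG.mem_of_adj ((hM i).subset_edgeSet _ he) with h | h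
    · exact ⟨b, h.2, he⟩
    · exact absurd h.1 (hUU' ha)
  have hother' : ∀ {i b}, b ∈ U' → (∃ e ∈ M i, b ∈ e) → ∃ a ∈ U, s(a, b) ∈ M i := by
    rintro i b hb ⟨e, he, hbe⟩
    obtain ⟨a, rfl⟩ := Sym2.mem_iff_exists.1 hbe
    rcases hG.mem_of_adj ((hM i).subset_edgeSet _ he) with h | h
    · exact absurd hb (hUU' h.1)
    · exact ⟨a, h.2, by rwa [Sym2.eq_swap]⟩
  set F := (T ×ˢ A ×ˢ B).filter fun p => s(p.2.1, p.2.2) ∈ M p.1 with hF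
  have hmem : ∀ p : F, p.1.1 ∈ T ∧ p.1.2.1 ∈ A ∧ p.1.2.2 ∈ B ∧ s(p.1.2.1, p.1.2.2) ∈ M p.1.1 := by
    intro p
    have := p.2
    simp only [hF, Finset.mem_filter, Finset.mem_product] at this
    tauto
  rw [← Fintype.card_coe F]
  let H := SimpleGraph.fromRel (suspensionRel G M (A := A) (B := B) (T := T))
  -- The antipodal pairs are the apex and the pole, `a` and the extra vertex of the `B` cluster, `b`
  -- and the extra vertex of the `A` cluster. The extra vertices are crossed so that each misses one
  -- end of `ab` yet is joined to the other end, which lies in its own clique.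
  refine card_le_maxQuasiRipsBetti k hd hα₀ hα₁
    (X := Option A ⊕ Option B ⊕ T ⊕ Unit) ?_ H suspensionCluster ?_ ?_
    (fun p => .inr (.inr (.inl ⟨p.1.1, (hmem p).1⟩))) (fun _ => .inr (.inr (.inr ())))
    (fun p => .inl (some ⟨p.1.2.1, (hmem p).2.1⟩)) (fun _ => .inr (.inl none))
    (fun p => .inr (.inl (some ⟨p.1.2.2, (hmem p).2.2.1⟩))) (fun _ => .inl none)
    ?_ ?_ ?_ ?_ ?_ ?_
  · simp only [Fintype.card_sum, Fintype.card_option, Fintype.card_coe, Fintype.card_unit]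
    omega
  · exact fun x y hxy h => ⟨hxy, Or.inl (suspensionRel_of_cluster_eq G M x y hxy h)⟩
  · exact fun x y hx hy h => h.2.elim (not_suspensionRel G M x y hx hy).1
      (not_suspensionRel G M x y hx hy).2
  · rintro ⟨⟨i, a, b⟩, hp⟩
    obtain ⟨h1, h2, h3, h4⟩ := hmem ⟨⟨i, a, b⟩, hp⟩
    have hadj : G.Adj a b := (hM i).subset_edgeSet _ h4
    have ha : ∃ e ∈ M i, a ∈ e := ⟨_, h4, by simp⟩
    have hb : ∃ e ∈ M i, b ∈ e := ⟨_, h4, by simp⟩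
    simp [H, SimpleGraph.fromRel_adj, suspensionRel, hadj, ha, hb]
  -- The triangle is a facet. Another `a'` or `b'` joined to all three would give a cross edge
  -- between two edges of `M i`; another apex `j` would force `ab` into `M j`, against disjointness;
  -- each extra vertex misses `a` or `b`, and the pole misses the apex.
  · rintro ⟨⟨i, a, b⟩, hp⟩ y hwy huy hvy
    obtain ⟨h1, h2, h3, h4⟩ := hmem ⟨⟨i, a, b⟩, hp⟩
    dsimp only at h1 h2 h3 h4
    rcases y with (_ | ⟨a', ha'⟩) | (_ | ⟨b', hb'⟩) | ⟨j, hj⟩ | _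
    · simp [H, SimpleGraph.fromRel_adj, suspensionRel] at hvy
    · simp [H, SimpleGraph.fromRel_adj, suspensionRel] at hwy huy hvy
      obtain ⟨b', hb', h5⟩ := hother (hA ha') hwy
      exact huy (huniq (hA ha') hb' (hA h2) (hB h3) h5 h4 hvy).1.symm
    · simp [H, SimpleGraph.fromRel_adj, suspensionRel] at huy
    · simp [H, SimpleGraph.fromRel_adj, suspensionRel] at hwy huy hvy
      obtain ⟨a', ha', h5⟩ := hother' (hB hb') hwy
      exact hvy (huniq (hA h2) (hB h3) ha' (hB hb') h4 h5 huy).2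
    · simp [H, SimpleGraph.fromRel_adj, suspensionRel] at hwy huy hvy
      obtain ⟨b', hb', h5⟩ := hother (hA h2) huy
      obtain ⟨a', ha', h6⟩ := hother' (hB h3) hvy
      obtain ⟨-, rfl⟩ := huniq (hA h2) hb' ha' (hB h3) h5 h6 ((hM i).subset_edgeSet _ h4)
      exact Finset.disjoint_left.1 (hdisj i j hwy) h4 h5
    · simp [H, SimpleGraph.fromRel_adj, suspensionRel] at hwy
  · rintro ⟨⟨i, a, b⟩, hp⟩ ⟨⟨j, a', b'⟩, hq⟩ h
    rw [Set.ext_iff] at h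
    have h1 := (h (.inr (.inr (.inl ⟨i, (hmem ⟨_, hp⟩).1⟩)))).1 (by simp)
    have h2 := (h (.inl (some ⟨a, (hmem ⟨_, hp⟩).2.1⟩))).1 (by simp)
    have h3 := (h (.inr (.inl (some ⟨b, (hmem ⟨_, hp⟩).2.2.1⟩)))).1 (by simp)
    simp at h1 h2 h3
    simp [h1, h2, h3]
  all_goals simp

/-- A set of at most `m * n` elements can be divided into `m` sets of at most `n` elements. -/
theorem exists_division {W : Type*} (A : Finset W) {m n : ℕ} (hm : 0 < m) (hA : A.card ≤ m * n) :
    ∃ c : W → Fin m, ∀ j, (A.filter fun x => c x = j).card ≤ n := by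
  classical
  rcases Nat.eq_zero_or_pos n with rfl | hn
  · rw [mul_zero, Nat.le_zero, Finset.card_eq_zero] at hA
    exact ⟨fun _ => ⟨0, hm⟩, by simp [hA]⟩
  let f : W → ℕ := fun x => if h : x ∈ A then (A.equivFin ⟨x, h⟩ : ℕ) else 0
  have hf : ∀ x, f x < m * n := by
    intro x
    by_cases h : x ∈ A
    · simp only [f, dif_pos h]; exact (Fin.is_lt _).trans_le hA
    · simp only [f, dif_neg h]; positivity
  have hinj : Set.InjOn f A := by
    intro x hx y hy hxy
    rw [Finset.mem_coe] at hx hy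
    simp only [f, dif_pos hx, dif_pos hy] at hxy
    exact congrArg Subtype.val (A.equivFin.injective (Fin.ext hxy))
  refine ⟨fun x => ⟨f x / n, Nat.div_lt_of_lt_mul (by rw [mul_comm]; exact hf x)⟩, fun j => ?_⟩
  refine le_of_le_of_eq ?_ (Finset.card_range n)
  refine Finset.card_le_card_of_injOn (fun x => f x % n)
    (fun x _ => Finset.mem_coe.2 (Finset.mem_range.2 (Nat.mod_lt _ hn))) ?_
  intro x hx y hy hxy
  rw [Finset.mem_coe, Finset.mem_filter] at hx hy
  refine hinj hx.1 hy.1 ?_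
  have h1 : f x / n = f y / n := congrArg Fin.val (hx.2.trans hy.2.symm)
  rw [← Nat.div_add_mod (f x) n, ← Nat.div_add_mod (f y) n, h1]
  exact congrArg _ hxy

/-- Some quasi-Rips complex has second Betti number at least `I(n) / 64`. -/
theorem maxInducedMatchings_le (k : Type*) [Field k] {d : ℕ} (hd : 2 ≤ d) {α : ℝ}
    (hα₀ : 0 < α) (hα₁ : α < 1) {n : ℕ} (hn : 24 ≤ n) :
    maxInducedMatchings n ≤ 64 * maxQuasiRipsBetti k α 2 d n := by
  classical
  obtain ⟨W, G, U, U', t, M, hG, -, hU, hU', ht, hM, hdisj, hsum⟩ :=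
    (isGreatest_maxInducedMatchings n).1
  -- The realizing complex on blocks of size `n'` has at most `3 * n' + 3 ≤ n` vertices, and `24 ≤
  -- n` ensures that four blocks cover `n` elements.
  set n' := n / 3 - 1 with hn'
  have h4 : n ≤ 4 * n' := by omega
  obtain ⟨cU, hcU⟩ := exists_division U (m := 4) (by norm_num) (hU.trans h4)
  obtain ⟨cU', hcU'⟩ := exists_division U' (m := 4) (by norm_num) (hU'.trans h4)
  obtain ⟨cT, hcT⟩ := exists_division (Finset.univ : Finset (Fin t)) (m := 4) (n := n')
    (by norm_num) (by rw [Finset.card_univ, Fintype.card_fin]; exact ht.trans h4)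
  let F : Finset (Fin t × W × W) :=
    (Finset.univ ×ˢ U ×ˢ U').filter fun p => s(p.2.1, p.2.2) ∈ M p.1
  have hle : ∑ i, (M i).card ≤ F.card := by
    rw [← Finset.card_sigma]
    refine Finset.card_le_card_of_surjOn (fun p => ⟨p.1, s(p.2.1, p.2.2)⟩) ?_
    rintro ⟨i, e⟩ he
    rw [Finset.mem_coe, Finset.mem_sigma] at he
    replace he := he.2
    have hadj := (hM i).subset_edgeSet e he
    induction e using Sym2.ind with
    | _ a b =>
      rcases hG.mem_of_adj hadj with ⟨ha, hb⟩ | ⟨ha, hb⟩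
      · exact ⟨(i, a, b), by simpa [F] using ⟨⟨ha, hb⟩, he⟩, rfl⟩
      · exact ⟨(i, b, a), by simpa [F] using ⟨⟨hb, ha⟩, by rwa [Sym2.eq_swap]⟩,
          by simp [Sym2.eq_swap]⟩
  rw [← hsum]
  refine hle.trans ?_
  -- Each of the `4 ^ 3` block triples contributes at most one maximal Betti number.
  have hfib := Finset.card_le_mul_card_image_of_maps_to (s := F)
    (t := (Finset.univ : Finset (Fin 4 × Fin 4 × Fin 4)))
    (f := fun p => (cT p.1, cU p.2.1, cU' p.2.2)) (fun _ _ => Finset.mem_univ _)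
    (maxQuasiRipsBetti k α 2 d n) ?_
  · simpa [mul_comm] using hfib
  rintro ⟨r, p, q⟩ -
  refine le_trans (Finset.card_le_card ?_) (card_filter_le_maxQuasiRipsBetti k hd hα₀ hα₁
    (n' := n') (by omega) hG hM hdisj (Finset.filter_subset (fun x => cU x = p) U)
    (Finset.filter_subset (fun x => cU' x = q) U') (hcU p) (hcU' q) (hcT r))
  rintro ⟨i, a, b⟩ h
  simp only [F, Finset.mem_filter, Finset.mem_product, Prod.mk.injEq] at h ⊢
  tauto

theorem maxInducedMatchings_pos {n : ℕ} (hn : 1 ≤ n) : 0 < maxInducedMatchings n := by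
  have h := sum_card_le_maxInducedMatchings (n := n) (⊤ : SimpleGraph Bool) {true} {false}
    (fun _ : Unit => {s(true, false)}) (by simpa using hn) ?_ ?_ (by simpa using hn)
    (by simpa using hn) ?_ ?_
  · simpa [Nat.succ_le_iff] using h
  · refine ⟨by simp, ?_⟩
    rintro (_ | _) (_ | _) <;> simp
  · ext x; cases x <;> simp
  · intro _
    refine ⟨by simp, ?_, ?_⟩
    · intro e he f hf hne
      exact absurd ((Finset.mem_singleton.1 he).trans (Finset.mem_singleton.1 hf).symm) hne
    · intro _ _ _ _ _ _ _ _ he hf hne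
      exact absurd ((Finset.mem_singleton.1 he).trans (Finset.mem_singleton.1 hf).symm) hne
  · intro i j hij
    exact absurd rfl hij

end LowerBound

end QuasiRips

end

theorem mainTheorem8 (d : ℕ) (hd : 2 ≤ d) (α : ℝ) (hα₀ : 0 < α) (hα₁ : α < 1) :
    ∃ C D : ℝ, 0 < C ∧ 0 < D ∧ ∃ N : ℕ, ∀ n : ℕ, N ≤ n →
      ∀ (k : Type*) [Field k],
        C * (QuasiRips.maxInducedMatchings n : ℝ)
            < (QuasiRips.maxQuasiRipsBetti k α 2 d n : ℝ) ∧
        (QuasiRips.maxQuasiRipsBetti k α 2 d n : ℝ)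
            < D * (QuasiRips.maxInducedMatchings n : ℝ) := by
  obtain ⟨D, hD⟩ := QuasiRips.exists_maxQuasiRipsBetti_le d hα₀
  -- Half of `1 / 64`, and `D` raised by `1`: since `I(n) > 0`, both weak bounds become strict.
  refine ⟨1 / 128, D + 1, by norm_num, by positivity, 24, fun n hn k _ => ?_⟩
  have h1 : (0 : ℝ) < QuasiRips.maxInducedMatchings n := by
    exact_mod_cast QuasiRips.maxInducedMatchings_pos (by omega)
  have h2 : (QuasiRips.maxInducedMatchings n : ℝ) ≤
      64 * (QuasiRips.maxQuasiRipsBetti k α 2 d n : ℝ) := by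
    exact_mod_cast QuasiRips.maxInducedMatchings_le k hd hα₀ hα₁ hn
  have h3 : (QuasiRips.maxQuasiRipsBetti k α 2 d n : ℝ) ≤
      D * (QuasiRips.maxInducedMatchings n : ℝ) := by
    exact_mod_cast hD n k
  constructor <;> linarith
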